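/- Let $d\ge 1$ and let $\mathcal M=\prod_{j=1}^d[L_{0,j},U_{0,j}]\subset\mathbb R^d$ be a box. \emph{Ordering rule.} A node of the infinite binary tree is a finite bit string $\sigma$. An ordering rule assigns to each node an axis $j(\sigma)\in\{1,\dots,d\}$, which is split there, and a bit $\mathrm{flip}(\sigma)$ telling whether the upper half is visited first; child $b\in\{0,1\}$ of $\sigma$ is the upper half iff $b\oplus \mathrm{flip}(\sigma)=1$. The rule is balanced with constant $c_s>0$ if there is $\kappa$ such that on the way to every node $\sigma$ of depth $L$ each axis has been split at least $c_sL/d-\kappa$ times. The $d$-dimensional Hilbert curve ordering (with its axis permutations and reflections) is such a rule, and it is balanced with $c_s=1$. For $t\in[0,1]$ let $\sigma_L(t)$ be the first $L$ binary digits of $t$. \emph{HiMAP quantile function.} Let $\mu$ be a probability measure with a density $f$ on $\mathcal M$ (and no mass outside), $0<m\le f\le M<\infty$ on $\mathcal M$. Starting from $\mathcal M$, the cell $\mathcal B$ at node $\sigma$ is cut along the axis $j=j(\sigma)$ at its conditional median $q=\inf\{x:\mu(u\in\mathcal B,\ u_j\le x)\ge \frac12\mu(\mathcal B)\}$, and the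 two halves are the cells of the children. Let $\mathbf H_{\mu,L}(t)\in\mathbb R^d$ have as $j$-th coordinate the most recent cut along axis $j$ among the first $L$ cuts on the path of $t$, and $\mathbf Q_\mu(t)=\lim_{L\to\infty}\mathbf H_{\mu,L}(t)$. \emph{Estimator.} For i.i.d. $\mathbf U_1,\mathbf U_2,\dots\sim\mu$, the sample tree splits $\{1,\dots,n\}$ recursively: at a node with index set $\mathcal I$ and axis $j$ the empirical median $\widehat q$ (the smallest $q$ with $\#\{i\in\mathcal I:(\mathbf U_i)_j\le q\}\ge\frac12\#\mathcal I$) is stored and $\mathcal I$ is split into $\{i:(\mathbf U_i)_j\le\widehat q\}$ (lower half) and the rest (upper half); a node with an empty half is not refined further. $\widehat{\mathbf Q}_{\mu,L}(t)$ collects for each axis the most recent stored cut on the path of $t$ of depth at most $L$. \emph{Claim.} The Hilbert ordering is balanced with $c_s=1$. Moreover, for all $d$, $\mathcal M$, $0<m$, $M$ and all constants $0<a$, $b$ there is $\gamma>0$, depending only on these, such that for every $\mu$ as above with density bounds $m,M$, every ordering rule that is balanced with a constant $c_s>0$, and every sequence of depths $L=L(n)$ with $a\log n\le L(n)\le b\log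 n$ for all large $n$: the limit $\mathbf Q_\mu(t)$ exists for all $t\in[0,1]$, the function $\widehat{\mathbf Q}_{\mu,L}-\mathbf Q_\mu$ is in $L^2([0,1];\mathbb R^d)$, and, as $n\to\infty$, \[ \sup_{t\in[0,1]}\big\|\widehat{\mathbf Q}_{\mu,L}(t)-\mathbf Q_\mu(t)\big\|_2=O_p\big(n^{-\frac{c_s}{2d\gamma}}\big), \] \[ d_{\mathrm{HiMAP},2}(\widehat\mu_n,\mu):=\Big(\int_0^1\big\|\widehat{\mathbf Q}_{\mu,L}(t)-\mathbf Q_\mu(t)\big\|_2^2\,dt\Big)^{1/2}=O_p\big(n^{-\frac{c_s}{2d\gamma}}\big). \] -/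

import Mathlib

open MeasureTheory ProbabilityTheory Filter Topology Set
open scoped ENNReal

namespace HiMAP

/-! ### Addresses and ordering rules

A node of the infinite binary tree is the list of the branch decisions that lead to it from the
root, the most recent decision first.  The decision `false` is the one taken by the smaller
values of the quantile level `t`. -/

/-- The `l`-th binary digit (`l ≥ 1`) of `t ∈ [0,1]`: the parity of the index of the dyadic
interval `[k 2⁻ˡ, (k+1) 2⁻ˡ)` that contains `t` (the last interval is closed at `1`). -/
noncomputable def bit (t : ℝ) (l : ℕ) : Bool :=
  (min ⌊t * 2 ^ l⌋₊ (2 ^ l - 1)).testBit 0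

/-- The address `σ_L(t)`: the first `L` binary digits of `t`, the most recent one first. -/
noncomputable def addr (t : ℝ) : ℕ → List Bool
  | 0 => []
  | l + 1 => bit t (l + 1) :: addr t l

/-- A recursive ordering rule in dimension `d`: at each node it prescribes the (geometric) axis
that is split there, and whether the two halves are visited in reversed order
(`flip σ = true`: the half with the larger coordinates comes first).  A deterministic schedule
`s` without reflections is `axis σ = s σ.length`, `flip σ = false`; the Hilbert curve is
`hilbertRule` below. -/
structure OrderingRule (d : ℕ) where
  axis : List Bool → Fin d
  flip : List Bool → Bool

variable {d : ℕ}

/-- Whether the branch decision `b` at the node `σ` leads to the upper half of the cell. -/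
def OrderingRule.goesUp (R : OrderingRule d) (σ : List Bool) (b : Bool) : Bool :=
  xor b (R.flip σ)

/-- Number of splits along the axis `j` on the way from the root to the node. -/
def OrderingRule.splitCount (R : OrderingRule d) (j : Fin d) : List Bool → ℕ
  | [] => 0
  | _ :: σ => R.splitCount j σ + if R.axis σ = j then 1 else 0

/-- Balanced splitting with constant `c`: on every path, and at every depth `L`, each axis has
been split at least `c L / d` times, up to an additive constant. -/
def OrderingRule.IsBalanced (R : OrderingRule d) (c : ℝ) : Prop :=
  ∃ κ : ℝ, ∀ (σ : List Bool) (j : Fin d), c * σ.length / d - κ ≤ R.splitCount j σ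

/-! ### The Hilbert curve

The `d`-dimensional Hilbert curve in its Gray code form.  The `d` binary digits read at one
macro-level form a digit `w ∈ {0, …, 2^d - 1}`, most significant bit first; the `r`-th of them
decides along the axis `dir + r`.  In the default orientation the `w`-th subcube is the one whose
position is the Gray code of `w`. For `d = 2` the order is LL, UL, UR, LR, with LL reflected
across the main diagonal and LR across the anti-diagonal. -/

/-- The binary reflected Gray code. -/
def grayCode (w : ℕ) : ℕ := w ^^^ (w / 2)

/-- Entry corner of the `w`-th subcube, in the default orientation. -/
def hilbertEntry (w : ℕ) : ℕ := grayCode (2 * ((w - 1) / 2))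

/-- Number of trailing ones in the binary expansion of `w`. -/
def trailingOnes (w : ℕ) : ℕ := padicValNat 2 (w + 1)

/-- Direction (bit number of the axis) in which the curve runs inside the `w`-th subcube, in the
default orientation. -/
def hilbertDir (w : ℕ) : ℕ :=
  if w = 0 then 0 else if w % 2 = 0 then trailingOnes (w - 1) else trailingOnes w

/-- Orientation of the Hilbert recursion at a node: the reflected axes, the first axis to be
split in the current macro-level, the value of the part of the current digit that has been read,
and the number of its bits. -/
structure HilbertState (d : ℕ) where
  refl : Fin d → Bool
  dir : Fin d
  digit : ℕ
  pos : ℕ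

/-- Read one more bit; when the digit is complete, pass to the orientation of the subcube. -/
def HilbertState.step [NeZero d] (S : HilbertState d) (b : Bool) : HilbertState d :=
  let w := 2 * S.digit + b.toNat
  if S.pos + 1 = d then
    { refl := fun j => xor (S.refl j) ((hilbertEntry w).testBit (d - 1 - (j - S.dir).val))
      dir := S.dir - Fin.ofNat d (hilbertDir w + 1)
      digit := 0
      pos := 0 }
  else
    { refl := S.refl, dir := S.dir, digit := w, pos := S.pos + 1 }

/-- Orientation at a node. -/
def hilbertState (d : ℕ) [NeZero d] : List Bool → HilbertState d
  | [] => { refl := fun _ => false, dir := 0, digit := 0, pos := 0 }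
  | b :: σ => (hilbertState d σ).step b

/-- The Hilbert curve ordering rule. -/
def hilbertRule (d : ℕ) [NeZero d] : OrderingRule d where
  axis σ := (hilbertState d σ).dir + Fin.ofNat d (hilbertState d σ).pos
  flip σ := xor
    ((hilbertState d σ).refl ((hilbertState d σ).dir + Fin.ofNat d (hilbertState d σ).pos))
    ((hilbertState d σ).digit.testBit 0)

lemma hilbertRule_splitCount (d : ℕ) [NeZero d] (σ : List Bool) :
    (hilbertState d σ).pos < d ∧ ∃ k : ℕ, σ.length = d * k + (hilbertState d σ).pos ∧
      ∀ j, (hilbertRule d).splitCount j σ =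
        k + if (j - (hilbertState d σ).dir).val < (hilbertState d σ).pos then 1 else 0 := by
  induction σ with
  | nil =>
    exact ⟨Nat.pos_of_ne_zero (NeZero.ne d), 0, by simp [hilbertState],
      by simp [hilbertState, OrderingRule.splitCount]⟩
  | cons b σ ih =>
    obtain ⟨hp, k, hk, hc⟩ := ih
    have hax : ∀ j, (hilbertRule d).axis σ = j ↔
        (j - (hilbertState d σ).dir).val = (hilbertState d σ).pos := by
      intro j
      have h1 : (hilbertRule d).axis σ = j ↔
          j - (hilbertState d σ).dir = Fin.ofNat d (hilbertState d σ).pos := by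
        simp only [hilbertRule]
        rw [sub_eq_iff_eq_add, add_comm, eq_comm]
      rw [h1, Fin.ext_iff]
      simp [Fin.ofNat, Nat.mod_eq_of_lt hp]
    by_cases h : (hilbertState d σ).pos + 1 = d
    · refine ⟨by simp [hilbertState, HilbertState.step, h, Nat.pos_of_ne_zero (NeZero.ne d)],
        k + 1, ?_, ?_⟩
      · simp only [hilbertState, HilbertState.step, h, if_true, List.length_cons, hk]
        rw [mul_add]; omega
      · intro j
        have := (j - (hilbertState d σ).dir).isLt
        simp only [hilbertState, HilbertState.step, h, if_true, OrderingRule.splitCount, hc, hax]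
        split_ifs <;> omega
    · refine ⟨by simp only [hilbertState, HilbertState.step, h, if_false]; omega, k, ?_, ?_⟩
      · simp only [hilbertState, HilbertState.step, h, if_false, List.length_cons, hk]
        omega
      · intro j
        simp only [hilbertState, HilbertState.step, h, if_false, OrderingRule.splitCount, hc, hax]
        split_ifs <;> omega

/-- The Hilbert curve splits every axis once per macro-level, hence it is balanced with
constant `1`. -/
theorem hilbertRule_isBalanced (d : ℕ) [NeZero d] : (hilbertRule d).IsBalanced 1 := by
  refine ⟨1, fun σ j => ?_⟩
  obtain ⟨hp, k, hk, hc⟩ := hilbertRule_splitCount d σ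
  have hd : (0 : ℝ) < d := by exact_mod_cast Nat.pos_of_ne_zero (NeZero.ne d)
  have h1 : (σ.length : ℝ) ≤ d * k + d := by rw [hk]; push_cast; gcongr
  have h2 : (k : ℝ) ≤ (hilbertRule d).splitCount j σ := by
    rw [hc]; exact_mod_cast Nat.le_add_right _ _
  have h3 : 1 * (σ.length : ℝ) / d ≤ k + 1 := by
    rw [div_le_iff₀ hd]; linarith
  linarith

/-! ### The population quantile map -/

/-- An axis-aligned box, given by its two extreme corners. -/
structure Cell (d : ℕ) where
  lo : Fin d → ℝ
  hi : Fin d → ℝ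

/-- The box as a closed subset of `ℝᵈ`. -/
def Cell.toSet (B : Cell d) : Set (EuclideanSpace ℝ (Fin d)) :=
  {u | ∀ j, u j ∈ Icc (B.lo j) (B.hi j)}

/-- Conditional median cut of the box `B` along the axis `j`. -/
noncomputable def Cell.cut (μ : Measure (EuclideanSpace ℝ (Fin d))) (B : Cell d) (j : Fin d) : ℝ :=
  sInf {x : ℝ | μ B.toSet / 2 ≤ μ {u | u ∈ B.toSet ∧ u j ≤ x}}

/-- The two halves of a box that is cut at the value `q` of the `j`-th coordinate. -/
def Cell.half (B : Cell d) (j : Fin d) (q : ℝ) (upper : Bool) : Cell d :=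
  if upper then { lo := Function.update B.lo j q, hi := B.hi }
  else { lo := B.lo, hi := Function.update B.hi j q }

/-- The mass-aligned cell of `μ` at a node; the root cell is the box `B₀`.  (Intersecting the
cells with the support of `μ` would not change the mass of any set, hence no cut.) -/
noncomputable def cell (μ : Measure (EuclideanSpace ℝ (Fin d))) (B₀ : Cell d)
    (R : OrderingRule d) : List Bool → Cell d
  | [] => B₀
  | b :: σ => (cell μ B₀ R σ).half (R.axis σ) ((cell μ B₀ R σ).cut μ (R.axis σ)) (R.goesUp σ b)

/-- For each axis, the most recent cut on the way from the root to the node (`0` for an axis that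
has not been split yet). -/
noncomputable def lastCuts (μ : Measure (EuclideanSpace ℝ (Fin d))) (B₀ : Cell d)
    (R : OrderingRule d) : List Bool → Fin d → ℝ
  | [] => 0
  | _ :: σ => Function.update (lastCuts μ B₀ R σ) (R.axis σ) ((cell μ B₀ R σ).cut μ (R.axis σ))

/-- The finite-depth map `H_{μ,L}`. -/
noncomputable def finiteMap (μ : Measure (EuclideanSpace ℝ (Fin d))) (B₀ : Cell d)
    (R : OrderingRule d) (L : ℕ) (t : ℝ) : EuclideanSpace ℝ (Fin d) :=
  WithLp.toLp 2 (lastCuts μ B₀ R (addr t L))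

/-- The HiMAP quantile function `Q_μ`. -/
noncomputable def quantileMap (μ : Measure (EuclideanSpace ℝ (Fin d))) (B₀ : Cell d)
    (R : OrderingRule d) (t : ℝ) : EuclideanSpace ℝ (Fin d) :=
  limUnder atTop fun L => finiteMap μ B₀ R L t

/-! ### The empirical quantile map -/

/-- Empirical median of the `j`-th coordinates of the sample points with index in `I`. -/
noncomputable def sampleMedian {n : ℕ} (x : Fin n → EuclideanSpace ℝ (Fin d))
    (I : Finset (Fin n)) (j : Fin d) : ℝ :=
  sInf {q : ℝ | (I.card : ℝ) / 2 ≤ (I.filter fun i => x i j ≤ q).card}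

/-- State of a traversal of the sample tree: the indices of the sample points in the current
node, the most recent cut value along each axis (`0` if there is none), and whether the node is
still to be split. -/
structure TreeState (n d : ℕ) where
  idx : Finset (Fin n)
  cuts : Fin d → ℝ
  active : Bool

/-- One step: split the current node at its empirical median along the axis `j`, store the cut
value and go to the lower or upper child; the traversal stops at a node with an empty child. -/
noncomputable def TreeState.step {n : ℕ} (x : Fin n → EuclideanSpace ℝ (Fin d)) (j : Fin d)
    (upper : Bool) (S : TreeState n d) : TreeState n d :=
  if S.active then
    let q := sampleMedian x S.idx j
    let I₀ := S.idx.filter fun i => x i j ≤ q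
    let I₁ := S.idx \ I₀
    if I₀ = ∅ ∨ I₁ = ∅ then
      { idx := S.idx, cuts := Function.update S.cuts j q, active := false }
    else
      { idx := if upper then I₁ else I₀, cuts := Function.update S.cuts j q, active := true }
  else S

/-- State after traversing the sample tree from the root to the given node. -/
noncomputable def treeState {n : ℕ} (x : Fin n → EuclideanSpace ℝ (Fin d)) (R : OrderingRule d) :
    List Bool → TreeState n d
  | [] => { idx := Finset.univ, cuts := 0, active := true }
  | b :: σ => (treeState x R σ).step x (R.axis σ) (R.goesUp σ b)

/-- The empirical HiMAP quantile function of depth `L`. -/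
noncomputable def empQuantileMap {n : ℕ} (x : Fin n → EuclideanSpace ℝ (Fin d))
    (R : OrderingRule d) (L : ℕ) (t : ℝ) : EuclideanSpace ℝ (Fin d) :=
  WithLp.toLp 2 (treeState x R (addr t L)).cuts

/-! ### Distance and stochastic order -/

/-- The HiMAP distance of order `2`: the `L²([0,1]; ℝᵈ)` distance of the quantile functions. -/
noncomputable def dist₂ (Q Q' : ℝ → EuclideanSpace ℝ (Fin d)) : ℝ≥0∞ :=
  (∫⁻ t in Icc (0 : ℝ) 1, ‖Q t - Q' t‖ₑ ^ 2) ^ (1 / 2 : ℝ)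

/-- `X n = O_p(r n)` as `n → ∞`. -/
def IsBigOp {Ω : Type*} [MeasurableSpace Ω] (P : Measure Ω) (X : ℕ → Ω → ℝ≥0∞) (r : ℕ → ℝ) :
    Prop :=
  ∀ ε : ℝ, 0 < ε → ∃ C : ℝ, ∀ᶠ n in atTop,
    P {ω | ENNReal.ofReal (C * r n) < X n ω} ≤ ENNReal.ofReal ε

end HiMAP

namespace HiMAP

variable {d : ℕ}

/-! ### Measures comparable with volume on boxes -/

/-! Write s = m/(2M). Since the density lies between m and M, a median cut leaves each child at
least the fraction s and at most 1 - s of the side that is cut. Hence a cell at depth k has volume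
at least s^k times that of the root, and its j-th side is at most (1 - s)^(number of splits along j)
times the original one (`cell_spec`). Balance sends the split counts to infinity, so the cuts along
a path converge, and the limit stays in every closed cell of the path (`quantileMap_mem`).

The sample tree is compared with the population tree on the event `GoodSample`, where all subboxes
have empirical mass within η of their true mass. Every empirical median then halves the true mass of
its sample cell up to 2η (`sampleMedian_mass`). By induction the corners of the sample cell differ
from those of the population cell by a fraction r of the sides, where r starts at order η and is
multiplied by a constant `growth` at each level (`cut_relError`, `treeState_spec`). With η of order
n^(-α) and K = ⌊δ log n⌋ for small δ, r still tends to 0 at depth K. From there on no control is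
needed: empirical medians are coordinates of sample points of the cell, so all later cuts remain in
the sample cell of depth K (`treeState_append_cuts_mem`). The error is thus at most a multiple of
the sides of the depth-K population cell, which are of order (1 - s)^(cK/d), a power of n; γ is read
off from it (`norm_sub_le`, `shrink_pow_le`).

Any polynomial rate η suffices, so `GoodSample` is obtained from Chebyshev's inequality, a union
bound over grid boxes and bracketing (`tendsto_measure_not_goodSample`). The bound is uniform in t,
and the L² rate follows from the uniform one. -/

/-- The half-open box with corners `lo` and `hi`. -/
def box (lo hi : Fin d → ℝ) : Set (EuclideanSpace ℝ (Fin d)) :=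
  {u | ∀ j, u j ∈ Ioc (lo j) (hi j)}

lemma measurable_coord (j : Fin d) : Measurable fun u : EuclideanSpace ℝ (Fin d) => u j := by
  fun_prop

lemma measurableSet_box (lo hi : Fin d → ℝ) : MeasurableSet (box lo hi) := by
  have : box lo hi = ⋂ j, (fun u : EuclideanSpace ℝ (Fin d) => u j) ⁻¹' Ioc (lo j) (hi j) := by
    ext u; simp [box]
  rw [this]
  exact MeasurableSet.iInter fun j => measurable_coord j measurableSet_Ioc

lemma measurableSet_toSet (B : Cell d) : MeasurableSet B.toSet := by
  have : B.toSet = ⋂ j, (fun u : EuclideanSpace ℝ (Fin d) => u j) ⁻¹' Icc (B.lo j) (B.hi j) := by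
    ext u; simp [Cell.toSet]
  rw [this]
  exact MeasurableSet.iInter fun j => measurable_coord j measurableSet_Icc

lemma volume_box (lo hi : Fin d → ℝ) :
    volume (box lo hi) = ∏ j, ENNReal.ofReal (hi j - lo j) := by
  rw [← Real.volume_pi_Ioc,
    ← (PiLp.volume_preserving_ofLp (Fin d)).measure_preimage
      (MeasurableSet.univ_pi fun _ => measurableSet_Ioc).nullMeasurableSet]
  congr 1
  ext u
  simp [box]

lemma volume_hyperplane (j : Fin d) (x : ℝ) :
    volume {u : EuclideanSpace ℝ (Fin d) | u j = x} = 0 := by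
  have h := Measure.pi_hyperplane (fun _ : Fin d => (volume : Measure ℝ)) j x
  rw [← volume_pi, ← (PiLp.volume_preserving_ofLp (Fin d)).measure_preimage
    (measurableSet_eq_fun (measurable_pi_apply j) measurable_const).nullMeasurableSet] at h
  exact h

/-- The measure `μ` lives on the box `B` and is comparable with volume on subboxes. -/
structure BoxBounds (μ : Measure (EuclideanSpace ℝ (Fin d))) (B : Cell d) (m M : ℝ) : Prop where
  pos : 0 < m
  le : m ≤ M
  lt : ∀ j, B.lo j < B.hi j
  -- Nonnegative majorants `w` of the sides let the bound cover empty boxes, where some `hi k - lo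
  -- k` is negative.
  upper : ∀ lo hi w : Fin d → ℝ, (∀ k, 0 ≤ w k) → (∀ k, hi k - lo k ≤ w k) →
    μ.real (box lo hi) ≤ M * ∏ k, w k
  lower : ∀ lo hi : Fin d → ℝ, B.lo ≤ lo → lo ≤ hi → hi ≤ B.hi →
    m * ∏ k, (hi k - lo k) ≤ μ.real (box lo hi)
  hyper : ∀ j x, μ {u | u j = x} = 0
  supp : ∀ᵐ u ∂μ, u ∈ box B.lo B.hi

/-- The density enters the proof only here; everything after it uses masses of boxes. Half-open
boxes split into disjoint half-open boxes under the rule `u j ≤ q`, and they carry the mass of the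
closed cells because hyperplanes are null. -/
lemma boxBounds_of_density (B : Cell d) {m M : ℝ} (hm : 0 < m)
    (μ : Measure (EuclideanSpace ℝ (Fin d))) [IsProbabilityMeasure μ]
    (f : EuclideanSpace ℝ (Fin d) → ℝ)
    (hμ : μ = (volume.restrict B.toSet).withDensity (fun u => ENNReal.ofReal (f u)))
    (hb : ∀ u ∈ B.toSet, m ≤ f u ∧ f u ≤ M) : BoxBounds μ B m M := by
  have hac : μ ≪ volume.restrict B.toSet := hμ ▸ withDensity_absolutelyContinuous _ _
  have hac' : μ ≪ volume := hac.trans Measure.absolutelyContinuous_restrict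
  have hyper : ∀ j x, μ {u | u j = x} = 0 := fun j x => hac' (volume_hyperplane j x)
  have hclosed : ∀ᵐ u ∂μ, u ∈ B.toSet :=
    hac (mem_ae_iff.1 (ae_restrict_mem (measurableSet_toSet B)))
  have hsupp : ∀ᵐ u ∂μ, u ∈ box B.lo B.hi := by
    have h1 : ∀ᵐ u ∂μ, ∀ j, u j ≠ B.lo j := by
      rw [ae_all_iff]
      intro j
      simpa [ae_iff] using hyper j (B.lo j)
    filter_upwards [hclosed, h1] with u hu hu' j
    exact ⟨lt_of_le_of_ne (hu j).1 (hu' j).symm, (hu j).2⟩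
  -- A probability measure charges some such point; it witnesses both `m ≤ M` and that no side of
  -- `B` is degenerate.
  obtain ⟨u₀, hu₀, hu₀'⟩ := (hclosed.and hsupp).exists
  have hmM : m ≤ M := (hb u₀ hu₀).1.trans (hb u₀ hu₀).2
  have hM : 0 ≤ M := hm.le.trans hmM
  have happ : ∀ s, MeasurableSet s → μ s = ∫⁻ u in s ∩ B.toSet, ENNReal.ofReal (f u) := by
    intro s hs
    rw [hμ, withDensity_apply _ hs, Measure.restrict_restrict hs]
  refine ⟨hm, hmM, fun j => (hu₀' j).1.trans_le (hu₀' j).2, ?_, ?_, hyper, hsupp⟩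
  · intro lo hi w hw hle
    apply ENNReal.toReal_le_of_le_ofReal (mul_nonneg hM (Finset.prod_nonneg fun k _ => hw k))
    calc μ (box lo hi) = ∫⁻ u in box lo hi ∩ B.toSet, ENNReal.ofReal (f u) :=
          happ _ (measurableSet_box _ _)
      _ ≤ ∫⁻ _ in box lo hi ∩ B.toSet, ENNReal.ofReal M :=
          setLIntegral_mono measurable_const fun u hu => ENNReal.ofReal_le_ofReal (hb u hu.2).2
      _ = ENNReal.ofReal M * volume (box lo hi ∩ B.toSet) := setLIntegral_const _ _
      _ ≤ ENNReal.ofReal M * volume (box lo hi) := by gcongr; exact inter_subset_left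
      _ ≤ ENNReal.ofReal (M * ∏ k, w k) := by
          rw [volume_box, ENNReal.ofReal_mul hM, ENNReal.ofReal_prod_of_nonneg fun k _ => hw k]
          gcongr with k
          exact hle k
  · intro lo hi h1 h2 h3
    have hsub : box lo hi ∩ B.toSet = box lo hi :=
      inter_eq_left.2 fun u hu j => ⟨(h1 j).trans (hu j).1.le, (hu j).2.trans (h3 j)⟩
    rw [measureReal_def, ← ENNReal.ofReal_le_iff_le_toReal (measure_ne_top _ _),
      happ _ (measurableSet_box _ _), hsub]
    calc ENNReal.ofReal (m * ∏ k, (hi k - lo k))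
        = ENNReal.ofReal m * volume (box lo hi) := by
          rw [volume_box, ENNReal.ofReal_mul hm.le,
            ENNReal.ofReal_prod_of_nonneg fun k _ => sub_nonneg.2 (h2 k)]
      _ = ∫⁻ _ in box lo hi, ENNReal.ofReal m := (setLIntegral_const _ _).symm
      _ ≤ ∫⁻ u in box lo hi, ENNReal.ofReal (f u) := by
          refine setLIntegral_mono' (measurableSet_box _ _) fun u hu => ?_
          rw [← hsub] at hu
          exact ENNReal.ofReal_le_ofReal (hb u hu.2).1

/-! ### Mass of a box under a perturbation of its corners -/

section Perturbation

variable {μ : Measure (EuclideanSpace ℝ (Fin d))} {B : Cell d} {m M : ℝ}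

lemma box_update_hi_eq (lo hi : Fin d → ℝ) (j : Fin d) {x : ℝ} (hx : x ≤ hi j) :
    box lo (Function.update hi j x) = box lo hi ∩ {u | u j ≤ x} := by
  ext u
  simp only [box, mem_ofPred_eq, mem_inter_iff]
  constructor
  · intro h
    have hj := h j
    simp only [Function.update_self] at hj
    refine ⟨fun k => ?_, hj.2⟩
    by_cases hk : k = j
    · subst hk; exact ⟨hj.1, hj.2.trans hx⟩
    · simpa [hk] using h k
  · rintro ⟨h, h'⟩ k
    by_cases hk : k = j
    · subst hk; simpa using ⟨(h k).1, h'⟩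
    · simpa [hk] using h k

lemma box_update_lo_eq (lo hi : Fin d → ℝ) (j : Fin d) {x : ℝ} (hx : lo j ≤ x) :
    box (Function.update lo j x) hi = box lo hi \ {u | u j ≤ x} := by
  ext u
  simp only [box, mem_ofPred_eq, Set.mem_sdiff, not_le]
  constructor
  · intro h
    have hj := h j
    simp only [Function.update_self] at hj
    refine ⟨fun k => ?_, hj.1⟩
    by_cases hk : k = j
    · subst hk; exact ⟨hx.trans_lt hj.1, hj.2⟩
    · simpa [hk] using h k
  · rintro ⟨h, h'⟩ k
    by_cases hk : k = j
    · subst hk; simpa using ⟨h', (h k).2⟩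
    · simpa [hk] using h k

lemma measureReal_box_split (μ : Measure (EuclideanSpace ℝ (Fin d))) [IsFiniteMeasure μ]
    (lo hi : Fin d → ℝ) (j : Fin d) {x : ℝ}
    (hx : x ∈ Icc (lo j) (hi j)) :
    μ.real (box lo (Function.update hi j x)) + μ.real (box (Function.update lo j x) hi) =
      μ.real (box lo hi) := by
  rw [box_update_hi_eq _ _ _ hx.2, box_update_lo_eq _ _ _ hx.1]
  exact measureReal_inter_add_sdiff (measurableSet_le (measurable_coord j) measurable_const)

/-- Moving the corners of a box changes its mass by at most the mass of the thin slabs between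
the old and the new faces. -/
lemma BoxBounds.perturb [IsFiniteMeasure μ] (h : BoxBounds μ B m M) {len lo hi lo' hi' : Fin d → ℝ}
    {r : ℝ}
    (hr : 0 ≤ r) (hlen : ∀ k, 0 ≤ len k) (h1 : ∀ k, hi k - lo k ≤ 2 * len k)
    (h2 : ∀ k, lo' k - lo k ≤ r * len k) (h3 : ∀ k, hi k - hi' k ≤ r * len k) :
    μ.real (box lo hi) ≤
      μ.real (box lo' hi') + d * 2 ^ (d + 1) * M * r * ∏ k, len k := by
  have hM : 0 ≤ M := h.pos.le.trans h.le
  -- A point of the old box outside the new one violates a new bound on some axis `i`. The d axes,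
  -- two faces each, and slabs with sides up to `2 * len k` give the constant `d * 2 ^ (d + 1)`.
  let S : Fin d → Set (EuclideanSpace ℝ (Fin d)) := fun i =>
    box lo (Function.update hi i (lo' i)) ∪ box (Function.update lo i (hi' i)) hi
  have hcov : box lo hi ⊆ box lo' hi' ∪ ⋃ i, S i := by
    intro u hu
    by_cases hu' : u ∈ box lo' hi'
    · exact Or.inl hu'
    · right
      simp only [box, mem_ofPred_eq, not_forall, mem_Ioc, not_and_or, not_lt, not_le] at hu'
      obtain ⟨i, hi⟩ := hu'
      refine mem_iUnion.2 ⟨i, ?_⟩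
      rcases hi with hi | hi
      · left
        intro k
        by_cases hk : k = i
        · subst hk; simpa using ⟨(hu k).1, hi⟩
        · simpa [hk] using hu k
      · right
        intro k
        by_cases hk : k = i
        · subst hk; simpa using ⟨hi, (hu k).2⟩
        · simpa [hk] using hu k
  have hslab : ∀ (i : Fin d) (a b : Fin d → ℝ), (∀ k, k ≠ i → b k - a k ≤ 2 * len k) →
      b i - a i ≤ r * len i → μ.real (box a b) ≤ M * (2 ^ d * (r * ∏ k, len k)) := by
    intro i a b hab hi
    refine (h.upper a b (fun k => 2 * (len k * if k = i then r else 1)) ?_ ?_).trans ?_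
    · intro k
      have := hlen k
      split_ifs <;> positivity
    · intro k
      by_cases hk : k = i
      · subst hk
        have := mul_nonneg hr (hlen k)
        simp only [if_true]
        nlinarith
      · simpa [hk] using hab k hk
    · rw [Finset.prod_mul_distrib, Finset.prod_mul_distrib, Finset.prod_ite_eq']
      simp [mul_comm]
  have hS : ∀ i, μ.real (S i) ≤ 2 * (M * (2 ^ d * (r * ∏ k, len k))) := by
    intro i
    refine (measureReal_union_le _ _).trans ?_
    rw [two_mul]
    refine add_le_add (hslab i _ _ ?_ ?_) (hslab i _ _ ?_ ?_)
    · intro k hk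
      simpa [hk] using h1 k
    · simpa using h2 i
    · intro k hk
      simpa [hk] using h1 k
    · simpa using h3 i
  calc μ.real (box lo hi) ≤ μ.real (box lo' hi' ∪ ⋃ i, S i) := measureReal_mono hcov
    _ ≤ μ.real (box lo' hi') + ∑ i, μ.real (S i) :=
        (measureReal_union_le _ _).trans (add_le_add le_rfl (measureReal_iUnion_fintype_le _))
    _ ≤ μ.real (box lo' hi') + ∑ _i : Fin d, 2 * (M * (2 ^ d * (r * ∏ k, len k))) := by
        gcongr with i
        exact hS i
    _ = _ := by
        rw [Finset.sum_const, Finset.card_univ, Fintype.card_fin, nsmul_eq_mul]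
        ring

end Perturbation

/-! ### The population cells -/

section Population

variable {μ : Measure (EuclideanSpace ℝ (Fin d))} {B : Cell d} {m M : ℝ}

/-- The side lengths of a cell. -/
def Cell.len (C : Cell d) (j : Fin d) : ℝ := C.hi j - C.lo j

/-- `C` is a subcell of `B`, possibly degenerate. -/
structure Cell.Sub (C B : Cell d) : Prop where
  lo : B.lo ≤ C.lo
  mid : C.lo ≤ C.hi
  hi : C.hi ≤ B.hi

lemma Cell.Sub.half {C : Cell d} (hC : C.Sub B) {j : Fin d} {q : ℝ}
    (hq : q ∈ Icc (C.lo j) (C.hi j)) (b : Bool) : (C.half j q b).Sub B := by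
  have h1 : B.lo j ≤ q := (hC.lo j).trans hq.1
  have h2 : q ≤ B.hi j := hq.2.trans (hC.hi j)
  cases b
  · refine ⟨hC.lo, fun k => ?_, fun k => ?_⟩ <;> by_cases hk : k = j
    · subst hk; simpa [Cell.half] using hq.1
    · simpa [Cell.half, hk] using hC.mid k
    · subst hk; simpa [Cell.half] using h2
    · simpa [Cell.half, hk] using hC.hi k
  · refine ⟨fun k => ?_, fun k => ?_, hC.hi⟩ <;> by_cases hk : k = j
    · subst hk; simpa [Cell.half] using h1
    · simpa [Cell.half, hk] using hC.lo k
    · subst hk; simpa [Cell.half] using hq.2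
    · simpa [Cell.half, hk] using hC.mid k

lemma Cell.half_len_of_ne (C : Cell d) {j k : Fin d} (hk : k ≠ j) (q : ℝ) (b : Bool) :
    (C.half j q b).len k = C.len k := by
  cases b <;> simp [Cell.half, Cell.len, hk]

lemma prod_eq_mul_sdiff (f : Fin d → ℝ) (j : Fin d) :
    ∏ k, f k = f j * ∏ k ∈ Finset.univ \ {j}, f k := by
  rw [← Finset.prod_update_of_mem (Finset.mem_univ j), Function.update_eq_self]

lemma BoxBounds.nonneg (h : BoxBounds μ B m M) : 0 < M := h.pos.trans_le h.le

/-- Mass of a slab of a box. -/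
lemma BoxBounds.slab [IsFiniteMeasure μ] (h : BoxBounds μ B m M) {C : Cell d} (hC : C.Sub B)
    (j : Fin d)
    {x y : ℝ} (hx : C.lo j ≤ x) (hxy : x ≤ y) (hy : y ≤ C.hi j) :
    m * ((y - x) * ∏ k ∈ Finset.univ \ {j}, C.len k) ≤
        μ.real (box C.lo (Function.update C.hi j y)) -
          μ.real (box C.lo (Function.update C.hi j x)) ∧
      μ.real (box C.lo (Function.update C.hi j y)) -
          μ.real (box C.lo (Function.update C.hi j x)) ≤
        M * ((y - x) * ∏ k ∈ Finset.univ \ {j}, C.len k) := by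
  have hs := measureReal_box_split μ C.lo (Function.update C.hi j y) j (x := x)
    (by simpa using ⟨hx, hxy⟩)
  rw [Function.update_idem] at hs
  have heq : ∀ k, Function.update C.hi j y k - Function.update C.lo j x k =
      Function.update C.len j (y - x) k := by
    intro k
    by_cases hk : k = j
    · subst hk; simp
    · simp [hk, Cell.len]
  have hprod : ∏ k, Function.update C.len j (y - x) k =
      (y - x) * ∏ k ∈ Finset.univ \ {j}, C.len k :=
    Finset.prod_update_of_mem (Finset.mem_univ j) _ _
  have hup := h.upper (Function.update C.lo j x) (Function.update C.hi j y)
    (Function.update C.len j (y - x)) (fun k => by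
      by_cases hk : k = j
      · subst hk; simpa using hxy
      · simpa [hk, Cell.len] using hC.mid k) (fun k => (heq k).le)
  have hlow := h.lower (Function.update C.lo j x) (Function.update C.hi j y)
    (fun k => by
      by_cases hk : k = j
      · subst hk; simpa using (hC.lo k).trans hx
      · simpa [hk] using hC.lo k)
    (fun k => by
      by_cases hk : k = j
      · subst hk; simpa using hxy
      · simpa [hk] using hC.mid k)
    (fun k => by
      by_cases hk : k = j
      · subst hk; simpa using hy.trans (hC.hi k)
      · simpa [hk] using hC.hi k)
  simp only [heq] at hlow
  rw [hprod] at hup hlow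
  constructor <;> linarith

lemma box_update_hi_empty (lo hi : Fin d → ℝ) (j : Fin d) :
    box lo (Function.update hi j (lo j)) = ∅ := by
  refine eq_empty_of_forall_notMem fun u hu => ?_
  have := hu j
  simp at this

lemma BoxBounds.toSet_ae_eq (h : BoxBounds μ B m M) (C : Cell d) :
    C.toSet =ᵐ[μ] box C.lo C.hi := by
  have h1 : ∀ᵐ u ∂μ, ∀ j, u j ≠ C.lo j := by
    rw [ae_all_iff]
    intro j
    simpa [ae_iff] using h.hyper j (C.lo j)
  filter_upwards [h1] with u hu
  refine propext ⟨fun hu' j => ⟨lt_of_le_of_ne (hu' j).1 (hu j).symm, (hu' j).2⟩,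
    fun hu' j => ⟨(hu' j).1.le, (hu' j).2⟩⟩

/-- The median cut halves the mass of the cell, and cuts off a fixed fraction of the side. -/
lemma BoxBounds.cut_spec [IsFiniteMeasure μ] (h : BoxBounds μ B m M) {C : Cell d} (hC : C.Sub B)
    (hlt : ∀ k, C.lo k < C.hi k) (j : Fin d) :
    μ.real (box C.lo (Function.update C.hi j (C.cut μ j))) = μ.real (box C.lo C.hi) / 2 ∧
      m / (2 * M) * C.len j ≤ C.cut μ j - C.lo j ∧
      m / (2 * M) * C.len j ≤ C.hi j - C.cut μ j := by
  set A : ℝ := ∏ k ∈ Finset.univ \ {j}, C.len k with hA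
  have hApos : 0 < A := Finset.prod_pos fun k _ => sub_pos.2 (hlt k)
  have hM := h.nonneg
  let G : ℝ → ℝ := fun x => μ.real (box C.lo (Function.update C.hi j x))
  have hG0 : G (C.lo j) = 0 := by simp [G, box_update_hi_empty]
  have hG1 : G (C.hi j) = μ.real (box C.lo C.hi) := by simp [G, Function.update_eq_self]
  have hslab : ∀ x y, C.lo j ≤ x → x ≤ y → y ≤ C.hi j →
      m * ((y - x) * A) ≤ G y - G x ∧ G y - G x ≤ M * ((y - x) * A) :=
    fun x y h1 h2 h3 => h.slab hC j h1 h2 h3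
  have hpos : 0 < μ.real (box C.lo C.hi) := by
    have := (hslab (C.lo j) (C.hi j) le_rfl (hlt j).le le_rfl).1
    rw [hG0, hG1, sub_zero] at this
    exact (mul_pos h.pos (mul_pos (sub_pos.2 (hlt j)) hApos)).trans_le this
  -- The upper slab bound makes `G` Lipschitz, so a point of exact halving exists; the lower slab
  -- bound makes it strictly increasing, so that point is the least one.
  have hcont : ContinuousOn G (Icc (C.lo j) (C.hi j)) := by
    refine (LipschitzOnWith.of_dist_le_mul (K := (M * A).toNNReal) ?_).continuousOn
    have key : ∀ x y, C.lo j ≤ x → x ≤ y → y ≤ C.hi j → dist (G x) (G y) ≤ M * A * dist x y := by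
      intro x y h1 h2 h3
      obtain ⟨ha, hb⟩ := hslab x y h1 h2 h3
      have h0 : 0 ≤ G y - G x :=
        (mul_nonneg h.pos.le (mul_nonneg (sub_nonneg.2 h2) hApos.le)).trans ha
      rw [dist_comm, Real.dist_eq, abs_of_nonneg h0, dist_comm, Real.dist_eq,
        abs_of_nonneg (sub_nonneg.2 h2)]
      linarith
    intro x hx y hy
    rw [Real.coe_toNNReal _ (by positivity)]
    rcases le_total x y with hxy | hxy
    · exact key x y hx.1 hxy hy.2
    · rw [dist_comm, dist_comm x]; exact key y x hy.1 hxy hx.2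
  obtain ⟨x₀, hx₀, hGx₀⟩ := intermediate_value_Icc (hlt j).le hcont
    (show μ.real (box C.lo C.hi) / 2 ∈ Icc (G (C.lo j)) (G (C.hi j)) by
      rw [hG0, hG1]; constructor <;> linarith)
  have hset : ∀ x, μ C.toSet / 2 ≤ μ {u | u ∈ C.toSet ∧ u j ≤ x} ↔
      μ.real (box C.lo C.hi) / 2 ≤ μ.real (box C.lo C.hi ∩ {u | u j ≤ x}) := by
    intro x
    have e1 : μ C.toSet = μ (box C.lo C.hi) := measure_congr (h.toSet_ae_eq C)
    have e2 : μ {u | u ∈ C.toSet ∧ u j ≤ x} = μ (box C.lo C.hi ∩ {u | u j ≤ x}) :=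
      measure_congr ((h.toSet_ae_eq C).inter (ae_eq_refl _))
    rw [e1, e2, ← ENNReal.toReal_le_toReal
      (ENNReal.div_ne_top (measure_ne_top _ _) (by simp)) (measure_ne_top _ _)]
    simp [measureReal_def]
  have hcut : C.cut μ j = x₀ := by
    refine IsLeast.csInf_eq ⟨?_, ?_⟩
    · rw [mem_ofPred_eq, hset, ← box_update_hi_eq _ _ _ hx₀.2]
      exact hGx₀.ge
    · intro x hx
      rw [mem_ofPred_eq, hset] at hx
      by_contra! hlt'
      have h1 : C.lo j < x₀ := by
        refine lt_of_le_of_ne hx₀.1 fun h' => ?_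
        rw [← h', hG0] at hGx₀
        linarith
      -- The competitor `x` may lie below the cell, where the slab bounds do not apply, so it is
      -- first raised to `C.lo j`.
      have h2 : max x (C.lo j) < x₀ := max_lt hlt' h1
      have h3 := (hslab _ x₀ (le_max_right x (C.lo j)) h2.le hx₀.2).1
      have h4 : 0 < m * ((x₀ - max x (C.lo j)) * A) :=
        mul_pos h.pos (mul_pos (sub_pos.2 h2) hApos)
      have h5 : μ.real (box C.lo C.hi ∩ {u | u j ≤ x}) ≤ G (max x (C.lo j)) := by
        simp only [G]
        rw [box_update_hi_eq _ _ _ (h2.le.trans hx₀.2)]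
        exact measureReal_mono (inter_subset_inter_right _ fun u hu =>
          le_trans (show u j ≤ x from hu) (le_max_left _ _))
      linarith
  rw [hcut]
  -- With A the product of the other sides, each half has mass at least m/2 · len · A and at most M
  -- · width · A, hence width at least m/(2M) · len.
  have hl := hslab _ _ le_rfl hx₀.1 hx₀.2
  have hu := hslab _ _ hx₀.1 hx₀.2 le_rfl
  have ht := (hslab _ _ le_rfl (hlt j).le le_rfl).1
  rw [hG0, hG1, sub_zero] at ht
  rw [hG0] at hl
  rw [hG1] at hu
  have hlen : C.hi j - C.lo j = C.len j := rfl
  refine ⟨hGx₀, ?_, ?_⟩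
  · have : m * (C.len j * A) ≤ 2 * M * (x₀ - C.lo j) * A := by
      rw [← hlen]; linarith [hl.2]
    rw [div_mul_eq_mul_div, div_le_iff₀ (by positivity)]
    have := le_of_mul_le_mul_right (by linarith : m * C.len j * A ≤ 2 * M * (x₀ - C.lo j) * A) hApos
    linarith
  · have : m * (C.len j * A) ≤ 2 * M * (C.hi j - x₀) * A := by
      rw [← hlen]; linarith [hu.2]
    rw [div_mul_eq_mul_div, div_le_iff₀ (by positivity)]
    have := le_of_mul_le_mul_right (by linarith : m * C.len j * A ≤ 2 * M * (C.hi j - x₀) * A) hApos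
    linarith

lemma BoxBounds.ratio_pos (h : BoxBounds μ B m M) : 0 < m / (2 * M) :=
  div_pos h.pos (mul_pos two_pos h.nonneg)

lemma BoxBounds.ratio_le (h : BoxBounds μ B m M) : m / (2 * M) ≤ 1 / 2 := by
  rw [div_le_iff₀ (mul_pos two_pos h.nonneg)]
  linarith [h.le]

/-- The cells are nondegenerate subcells of the root, and their sides shrink geometrically, but
not faster than geometrically. -/
lemma BoxBounds.cell_spec [IsFiniteMeasure μ] (h : BoxBounds μ B m M) (R : OrderingRule d)
    (σ : List Bool) :
    (cell μ B R σ).Sub B ∧ (∀ k, (cell μ B R σ).lo k < (cell μ B R σ).hi k) ∧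
      (m / (2 * M)) ^ σ.length * ∏ k, B.len k ≤ ∏ k, (cell μ B R σ).len k ∧
      ∀ k, (cell μ B R σ).len k ≤ B.len k * (1 - m / (2 * M)) ^ R.splitCount k σ := by
  induction σ with
  | nil =>
    refine ⟨⟨le_rfl, fun j => (h.lt j).le, le_rfl⟩, h.lt, by simp [cell], fun k => ?_⟩
    simp [cell, OrderingRule.splitCount]
  | cons b σ ih =>
    obtain ⟨hC, hlt, hvol, hlen⟩ := ih
    set C := cell μ B R σ
    set j := R.axis σ with hj
    obtain ⟨-, hq1, hq2⟩ := h.cut_spec hC hlt j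
    have hlenpos : ∀ k, 0 < C.len k := fun k => sub_pos.2 (hlt k)
    have hspos := mul_pos h.ratio_pos (hlenpos j)
    have hq : C.cut μ j ∈ Icc (C.lo j) (C.hi j) := ⟨by linarith, by linarith⟩
    have hcell : cell μ B R (b :: σ) = C.half j (C.cut μ j) (R.goesUp σ b) := rfl
    rw [hcell]
    have hself : m / (2 * M) * C.len j ≤ (C.half j (C.cut μ j) (R.goesUp σ b)).len j ∧
        (C.half j (C.cut μ j) (R.goesUp σ b)).len j ≤ C.len j * (1 - m / (2 * M)) := by
      have hL : C.len j = C.hi j - C.lo j := rfl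
      cases R.goesUp σ b
      · simp only [Cell.half, Cell.len, Function.update_self, Bool.false_eq_true, if_false]
        rw [hL] at hq1 hq2
        constructor <;> linarith
      · simp only [Cell.half, Cell.len, Function.update_self, if_true]
        rw [hL] at hq1 hq2
        constructor <;> linarith
    refine ⟨hC.half hq _, fun k => ?_, ?_, fun k => ?_⟩
    · rw [← sub_pos]
      change 0 < (C.half j (C.cut μ j) (R.goesUp σ b)).len k
      by_cases hk : k = j
      · rw [hk]; linarith [hself.1]
      · rw [Cell.half_len_of_ne _ hk]; exact hlenpos k
    · rw [prod_eq_mul_sdiff (C.half j (C.cut μ j) (R.goesUp σ b)).len j]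
      have : ∏ k ∈ Finset.univ \ {j}, (C.half j (C.cut μ j) (R.goesUp σ b)).len k =
          ∏ k ∈ Finset.univ \ {j}, C.len k :=
        Finset.prod_congr rfl fun k hk => Cell.half_len_of_ne _ (by simpa using hk) _ _
      rw [this]
      have hA : 0 ≤ ∏ k ∈ Finset.univ \ {j}, C.len k := Finset.prod_nonneg fun k _ => (hlenpos k).le
      calc (m / (2 * M)) ^ (b :: σ).length * ∏ k, B.len k
          = m / (2 * M) * ((m / (2 * M)) ^ σ.length * ∏ k, B.len k) := by
            rw [List.length_cons]; ring
        _ ≤ m / (2 * M) * ∏ k, C.len k := by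
            gcongr
            exact h.ratio_pos.le
        _ = m / (2 * M) * C.len j * ∏ k ∈ Finset.univ \ {j}, C.len k := by
            rw [prod_eq_mul_sdiff _ j]; ring
        _ ≤ _ := by gcongr; exact hself.1
    · by_cases hk : k = j
      · rw [hk]
        refine hself.2.trans ?_
        simp only [OrderingRule.splitCount, ← hj, if_true]
        rw [pow_succ, ← mul_assoc]
        gcongr
        · linarith [h.ratio_le]
        · exact hlen j
      · rw [Cell.half_len_of_ne _ hk]
        simpa [OrderingRule.splitCount, ← hj, Ne.symm hk] using hlen k

lemma BoxBounds.cut_mem [IsFiniteMeasure μ] (h : BoxBounds μ B m M) (R : OrderingRule d)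
    (σ : List Bool) (j : Fin d) :
    (cell μ B R σ).cut μ j ∈ Icc ((cell μ B R σ).lo j) ((cell μ B R σ).hi j) := by
  obtain ⟨hC, hlt, -, -⟩ := h.cell_spec R σ
  obtain ⟨-, hq1, hq2⟩ := h.cut_spec hC hlt j
  have := mul_pos h.ratio_pos (sub_pos.2 (hlt j))
  simp only [Cell.len] at hq1 hq2
  exact ⟨by linarith, by linarith⟩

lemma Cell.Sub.refl {C : Cell d} (h : C.lo ≤ C.hi) : C.Sub C := ⟨le_rfl, h, le_rfl⟩

lemma BoxBounds.cell_append_sub [IsFiniteMeasure μ] (h : BoxBounds μ B m M) (R : OrderingRule d)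
    (τ σ : List Bool) : (cell μ B R (τ ++ σ)).Sub (cell μ B R σ) := by
  induction τ with
  | nil => exact Cell.Sub.refl (h.cell_spec R σ).1.mid
  | cons b τ ih => exact ih.half (h.cut_mem R _ _) _

lemma OrderingRule.splitCount_append (R : OrderingRule d) (j : Fin d) (τ σ : List Bool) :
    R.splitCount j σ ≤ R.splitCount j (τ ++ σ) := by
  induction τ with
  | nil => exact le_rfl
  | cons b τ ih => exact ih.trans (Nat.le_add_right _ _)

lemma Cell.mem_half_self {C : Cell d} {j : Fin d} {q : ℝ} (hq : q ∈ Icc (C.lo j) (C.hi j))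
    (b : Bool) : q ∈ Icc ((C.half j q b).lo j) ((C.half j q b).hi j) := by
  cases b
  · simpa [Cell.half] using hq.1
  · simpa [Cell.half] using hq.2

lemma Cell.half_of_ne (C : Cell d) {j k : Fin d} (hk : k ≠ j) (q : ℝ) (b : Bool) :
    (C.half j q b).lo k = C.lo k ∧ (C.half j q b).hi k = C.hi k := by
  cases b <;> simp [Cell.half, hk]

/-- A cut along `j` becomes a face of the child, and cuts along other axes leave that side
unchanged. A positive split count excludes the default value 0, which may lie outside the cell. -/
lemma BoxBounds.lastCuts_mem [IsFiniteMeasure μ] (h : BoxBounds μ B m M) (R : OrderingRule d)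
    (σ : List Bool) (j : Fin d) (hj : 0 < R.splitCount j σ) :
    lastCuts μ B R σ j ∈ Icc ((cell μ B R σ).lo j) ((cell μ B R σ).hi j) := by
  induction σ with
  | nil => simp [OrderingRule.splitCount] at hj
  | cons b σ ih =>
    by_cases hk : j = R.axis σ
    · subst hk
      simp only [lastCuts, Function.update_self]
      exact Cell.mem_half_self (h.cut_mem R _ _) _
    · simp only [lastCuts, Function.update_of_ne hk, cell]
      rw [(Cell.half_of_ne _ hk _ _).1, (Cell.half_of_ne _ hk _ _).2]
      exact ih (by simpa [OrderingRule.splitCount, Ne.symm hk] using hj)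

lemma addr_add (t : ℝ) (K l : ℕ) : ∃ τ, addr t (K + l) = τ ++ addr t K := by
  induction l with
  | zero => exact ⟨[], rfl⟩
  | succ l ih =>
    obtain ⟨τ, hτ⟩ := ih
    exact ⟨bit t (K + l + 1) :: τ, by rw [← add_assoc, addr, hτ]; rfl⟩

lemma addr_of_le (t : ℝ) {K l : ℕ} (hl : K ≤ l) : ∃ τ, addr t l = τ ++ addr t K := by
  obtain ⟨k, rfl⟩ := Nat.exists_eq_add_of_le hl
  exact addr_add t K k

lemma length_addr (t : ℝ) (l : ℕ) : (addr t l).length = l := by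
  induction l with
  | zero => rfl
  | succ l ih => simp [addr, ih]

lemma BoxBounds.lastCuts_addr_mem [IsFiniteMeasure μ] (h : BoxBounds μ B m M)
    (R : OrderingRule d) (t : ℝ) {K l : ℕ} (hl : K ≤ l) (j : Fin d)
    (hj : 0 < R.splitCount j (addr t K)) :
    lastCuts μ B R (addr t l) j ∈
      Icc ((cell μ B R (addr t K)).lo j) ((cell μ B R (addr t K)).hi j) := by
  obtain ⟨τ, hτ⟩ := addr_of_le t hl
  rw [hτ]
  have h1 := h.lastCuts_mem R (τ ++ addr t K) j (hj.trans_le (R.splitCount_append j _ _))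
  have h2 := h.cell_append_sub R τ (addr t K)
  exact ⟨(h2.lo j).trans h1.1, h1.2.trans (h2.hi j)⟩

lemma OrderingRule.IsBalanced.tendsto_splitCount {R : OrderingRule d} {c : ℝ}
    (hR : R.IsBalanced c) (hc : 0 < c) (j : Fin d) (t : ℝ) :
    Tendsto (fun l => R.splitCount j (addr t l)) atTop atTop := by
  obtain ⟨κ, hκ⟩ := hR
  have hd : (0 : ℝ) < d := by exact_mod_cast j.pos
  rw [← tendsto_natCast_atTop_iff (R := ℝ)]
  refine tendsto_atTop_mono (fun l => hκ (addr t l) j) ?_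
  simp only [length_addr]
  have : Tendsto (fun l : ℕ => c / d * (l : ℝ) + -κ) atTop atTop :=
    tendsto_atTop_add_const_right _ _
      (tendsto_natCast_atTop_atTop.const_mul_atTop (div_pos hc hd))
  refine this.congr fun l => ?_
  ring

/-- Each coordinate is Cauchy: from some depth on, all cuts along `j` lie in one cell side, whose
length decays geometrically in the split count. -/
lemma BoxBounds.tendsto_quantileMap [IsFiniteMeasure μ] (h : BoxBounds μ B m M)
    {R : OrderingRule d} {c : ℝ} (hR : R.IsBalanced c) (hc : 0 < c) (t : ℝ) :
    Tendsto (fun l => finiteMap μ B R l t) atTop (𝓝 (quantileMap μ B R t)) := by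
  refine tendsto_nhds_limUnder ?_
  have hcoord : ∀ j, ∃ x, Tendsto (fun l => lastCuts μ B R (addr t l) j) atTop (𝓝 x) := by
    intro j
    refine cauchySeq_tendsto_of_complete (Metric.cauchySeq_iff'.2 fun ε hε => ?_)
    have hgeo : Tendsto (fun l => B.len j * (1 - m / (2 * M)) ^ R.splitCount j (addr t l)) atTop
        (𝓝 (B.len j * 0)) :=
      ((tendsto_pow_atTop_nhds_zero_of_lt_one (by linarith [h.ratio_le])
        (by linarith [h.ratio_pos])).comp (hR.tendsto_splitCount hc j t)).const_mul _
    rw [mul_zero] at hgeo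
    obtain ⟨N, hN1, hN2⟩ := ((hgeo.eventually (gt_mem_nhds hε)).and
      ((hR.tendsto_splitCount hc j t).eventually_gt_atTop 0)).exists
    refine ⟨N, fun n hn => ?_⟩
    have h1 := h.lastCuts_addr_mem R t hn j hN2
    have h2 := h.lastCuts_addr_mem R t le_rfl j hN2
    have h3 := (h.cell_spec R (addr t N)).2.2.2 j
    refine lt_of_le_of_lt (Real.dist_le_of_mem_Icc h1 h2) (lt_of_le_of_lt h3 hN1)
  choose x hx using hcoord
  refine ⟨WithLp.toLp 2 x, ?_⟩
  exact ((PiLp.continuous_toLp 2 _).tendsto x).comp (tendsto_pi_nhds.2 hx)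

lemma BoxBounds.quantileMap_mem [IsFiniteMeasure μ] (h : BoxBounds μ B m M)
    {R : OrderingRule d} {c : ℝ} (hR : R.IsBalanced c) (hc : 0 < c) (t : ℝ) (K : ℕ) (j : Fin d)
    (hj : 0 < R.splitCount j (addr t K)) :
    quantileMap μ B R t j ∈
      Icc ((cell μ B R (addr t K)).lo j) ((cell μ B R (addr t K)).hi j) := by
  have h1 := ((EuclideanSpace.proj (𝕜 := ℝ) j).continuous.tendsto _).comp
    (h.tendsto_quantileMap hR hc t)
  exact isClosed_Icc.mem_of_tendsto h1
    (eventually_atTop.2 ⟨K, fun l hl => h.lastCuts_addr_mem R t hl j hj⟩)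

end Population

/-! ### The sample tree -/

section Sample

variable {μ : Measure (EuclideanSpace ℝ (Fin d))} {B : Cell d} {m M : ℝ} {n : ℕ}
  {x : Fin n → EuclideanSpace ℝ (Fin d)}

open Classical in
/-- Empirical mass of a set. -/
noncomputable def empMass (x : Fin n → EuclideanSpace ℝ (Fin d))
    (S : Set (EuclideanSpace ℝ (Fin d))) : ℝ :=
  (Finset.univ.filter fun i => x i ∈ S).card / n

lemma empMass_eq {S : Set (EuclideanSpace ℝ (Fin d))} {I : Finset (Fin n)}
    (hI : ∀ i, i ∈ I ↔ x i ∈ S) : empMass x S = I.card / n := by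
  classical
  have : I = Finset.univ.filter fun i => x i ∈ S := by ext i; simp [hI]
  rw [empMass, this]

/-- The sample lies in the box `B`, and its empirical mass is uniformly close to the mass of `μ`
on subboxes of `B`. -/
structure GoodSample (μ : Measure (EuclideanSpace ℝ (Fin d))) (B : Cell d)
    (x : Fin n → EuclideanSpace ℝ (Fin d)) (η : ℝ) : Prop where
  mem : ∀ i, x i ∈ box B.lo B.hi
  dev : ∀ C : Cell d, C.Sub B → |empMass x (box C.lo C.hi) - μ.real (box C.lo C.hi)| ≤ η

/-- The number of points with coordinate at most `q` jumps only at sample coordinates, so the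
infimum is attained, and at one of them. -/
lemma sampleMedian_spec {I : Finset (Fin n)} (hI : I.Nonempty) (j : Fin d) :
    (∃ i ∈ I, sampleMedian x I j = x i j) ∧
      IsLeast {q : ℝ | (I.card : ℝ) / 2 ≤ (I.filter fun i => x i j ≤ q).card}
        (sampleMedian x I j) := by
  classical
  set Q : Set ℝ := {q : ℝ | (I.card : ℝ) / 2 ≤ (I.filter fun i => x i j ≤ q).card} with hQ
  have hpos : (0 : ℝ) < I.card := by exact_mod_cast hI.card_pos
  have hne : (I.filter fun i => x i j ∈ Q).Nonempty := by
    obtain ⟨i, hi, hmax⟩ := I.exists_max_image (fun i => x i j) hI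
    refine ⟨i, Finset.mem_filter.2 ⟨hi, ?_⟩⟩
    have : (I.filter fun k => x k j ≤ x i j) = I := Finset.filter_true_of_mem hmax
    rw [hQ, mem_ofPred_eq, this]
    linarith
  obtain ⟨i, hi, hmin⟩ := Finset.exists_min_image _ (fun i => x i j) hne
  rw [Finset.mem_filter] at hi
  have hleast : IsLeast Q (x i j) := by
    refine ⟨hi.2, fun y hy => ?_⟩
    have hy' : (I.filter fun i => x i j ≤ y).Nonempty := by
      rw [← Finset.card_pos]
      have : (0 : ℝ) < (I.filter fun i => x i j ≤ y).card := lt_of_lt_of_le (by linarith) hy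
      exact_mod_cast this
    obtain ⟨k, hk, hmax⟩ := Finset.exists_max_image _ (fun i => x i j) hy'
    rw [Finset.mem_filter] at hk
    have heq : (I.filter fun i => x i j ≤ y) = I.filter fun i => x i j ≤ x k j := by
      ext l
      simp only [Finset.mem_filter]
      exact ⟨fun hl => ⟨hl.1, hmax l (Finset.mem_filter.2 hl)⟩, fun hl => ⟨hl.1, hl.2.trans hk.2⟩⟩
    have hkQ : x k j ∈ Q := by
      rw [hQ, mem_ofPred_eq, ← heq]; exact hy
    exact (hmin k (Finset.mem_filter.2 ⟨hk.1, hkQ⟩)).trans hk.2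
  have heq : sampleMedian x I j = x i j := hleast.csInf_eq
  rw [heq]
  exact ⟨⟨i, hi.1, rfl⟩, hleast⟩

/-- An empirical median nearly halves the mass of the cell. -/
lemma BoxBounds.sampleMedian_mass [IsFiniteMeasure μ] (h : BoxBounds μ B m M) {η : ℝ} (hη : 0 < η)
    (hx : GoodSample μ B x η) {C : Cell d} (hC : C.Sub B) {I : Finset (Fin n)}
    (hI : ∀ i, i ∈ I ↔ x i ∈ box C.lo C.hi) (hne : I.Nonempty) (j : Fin d) :
    sampleMedian x I j ∈ Icc (C.lo j) (C.hi j) ∧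
      |μ.real (box C.lo (Function.update C.hi j (sampleMedian x I j))) -
        μ.real (box C.lo C.hi) / 2| ≤ 2 * η := by
  obtain ⟨⟨i, hi, hqi⟩, hmem, hleast⟩ := sampleMedian_spec (x := x) hne j
  set q := sampleMedian x I j with hq
  have hn : (0 : ℝ) < n := by exact_mod_cast i.pos
  have hqI : q ∈ Ioc (C.lo j) (C.hi j) := by rw [hqi]; exact (hI i).1 hi j
  refine ⟨⟨hqI.1.le, hqI.2⟩, ?_⟩
  have hhalf : ∀ y, C.lo j ≤ y → y ≤ C.hi j →
      |(I.filter fun i => x i j ≤ y).card / n -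
        μ.real (box C.lo (Function.update C.hi j y))| ≤ η := by
    intro y h1 h2
    have := hx.dev (C.half j y false) (hC.half ⟨h1, h2⟩ false)
    simp only [Cell.half, Bool.false_eq_true, if_false] at this
    rwa [empMass_eq (I := I.filter fun i => x i j ≤ y)] at this
    intro i
    rw [box_update_hi_eq _ _ _ h2, Finset.mem_filter, hI]
    rfl
  have htot := hx.dev C hC
  rw [empMass_eq hI] at htot
  have hq1 := hhalf q hqI.1.le hqI.2
  rw [abs_le] at htot hq1 ⊢
  have hmem' : (I.card : ℝ) / n / 2 ≤ (I.filter fun i => x i j ≤ q).card / n := by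
    rw [div_right_comm]
    gcongr
    exact hmem
  -- Below, the errors are η for the half and η/2 for half of the total. Above, a further η/2 pays
  -- for a thin slab left of `q`: by minimality fewer than half of the points are at most `y`. The
  -- `+ 1` in the width of the slab covers degenerate cells, where `A` may vanish.
  constructor
  · linarith [htot.1]
  · set A : ℝ := ∏ k ∈ Finset.univ \ {j}, C.len k with hA
    have hA0 : 0 ≤ A := Finset.prod_nonneg fun k _ => sub_nonneg.2 (hC.mid k)
    have hM := h.nonneg
    obtain ⟨y, hy1, hy2⟩ := exists_between
      (max_lt hqI.1 (sub_lt_self q (show 0 < η / (2 * (M * A + 1)) by positivity)))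
    have hyl : C.lo j ≤ y := (le_max_left _ _).trans hy1.le
    have hyq : q - η / (2 * (M * A + 1)) ≤ y := (le_max_right _ _).trans hy1.le
    have hslab := (h.slab hC j hyl hy2.le hqI.2).2
    have hy3 : (I.filter fun i => x i j ≤ y).card / n ≤ (I.card : ℝ) / n / 2 := by
      rw [div_right_comm]
      gcongr
      by_contra! hcon
      exact absurd (hleast hcon.le) (not_le.2 hy2)
    have hy4 := abs_le.1 (hhalf y hyl (hy2.le.trans hqI.2))
    have h5 : M * ((q - y) * A) ≤ η / 2 := by
      have : (q - y) * (2 * (M * A + 1)) ≤ η := by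
        rw [← le_div_iff₀ (by positivity)]; linarith
      nlinarith [sub_pos.2 hy2]
    rw [← hA] at hslab
    linarith [hy4.1, htot.2]

/-- Each box takes its turn as the original one in `perturb`, which is why sides up to `2 * len k`
are allowed there. -/
lemma BoxBounds.abs_perturb [IsFiniteMeasure μ] (h : BoxBounds μ B m M)
    {len lo hi lo' hi' : Fin d → ℝ} {r : ℝ} (hr : 0 ≤ r) (hlen : ∀ k, 0 ≤ len k)
    (h1 : ∀ k, hi k - lo k ≤ 2 * len k) (h1' : ∀ k, hi' k - lo' k ≤ 2 * len k)
    (h2 : ∀ k, |lo' k - lo k| ≤ r * len k) (h3 : ∀ k, |hi' k - hi k| ≤ r * len k) :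
    |μ.real (box lo hi) - μ.real (box lo' hi')| ≤ d * 2 ^ (d + 1) * M * r * ∏ k, len k := by
  have ha := h.perturb hr hlen h1 (fun k => (abs_le.1 (h2 k)).2)
    (hi' := hi') (fun k => by linarith [(abs_le.1 (h3 k)).1])
  have hb := h.perturb hr hlen h1' (lo' := lo) (hi' := hi)
    (fun k => by linarith [(abs_le.1 (h2 k)).1])
    (fun k => (abs_le.1 (h3 k)).2)
  rw [abs_le]
  constructor <;> linarith

/-- The corners of the cells `C` and `C'` differ by at most the fraction `r` of the sides of
`C`. -/
def Cell.Close (C C' : Cell d) (r : ℝ) : Prop :=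
  ∀ k, |C'.lo k - C.lo k| ≤ r * C.len k ∧ |C'.hi k - C.hi k| ≤ r * C.len k

lemma BoxBounds.abs_sub_le_of_close [IsFiniteMeasure μ] (h : BoxBounds μ B m M) {C C' : Cell d}
    {r : ℝ} (hr : 0 ≤ r) (hr' : r ≤ 1 / 2) (hlt : ∀ k, C.lo k < C.hi k) (hclose : C.Close C' r) :
    |μ.real (box C.lo C.hi) - μ.real (box C'.lo C'.hi)| ≤
      d * 2 ^ (d + 1) * M * r * ∏ k, C.len k := by
  have hlen : ∀ k, 0 < C.len k := fun k => sub_pos.2 (hlt k)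
  refine h.abs_perturb hr (fun k => (hlen k).le) (fun k => ?_) (fun k => ?_)
    (fun k => (hclose k).1) (fun k => (hclose k).2)
  · have := hlen k; simp only [Cell.len] at *; linarith
  · have h1 := abs_le.1 (hclose k).1
    have h2 := abs_le.1 (hclose k).2
    have h3 := mul_le_mul_of_nonneg_right hr' (hlen k).le
    simp only [Cell.len] at *
    linarith

/-- An approximate median cut of a cell is close to the median cut of a nearby cell. -/
lemma BoxBounds.cut_close [IsFiniteMeasure μ] (h : BoxBounds μ B m M) {C C' : Cell d}
    (hC : C.Sub B) (hlt : ∀ k, C.lo k < C.hi k) {r η q : ℝ} (hr : 0 ≤ r)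
    (hr' : r ≤ 1 / 2) (hclose : C.Close C' r) (j : Fin d) (hq : q ∈ Icc (C'.lo j) (C'.hi j))
    (hmass : |μ.real (box C'.lo (Function.update C'.hi j q)) -
        μ.real (box C'.lo C'.hi) / 2| ≤ 2 * η) :
    m * (∏ k, C.len k) * |q - C.cut μ j| ≤
      C.len j * (m * r * (∏ k, C.len k) +
        3 / 2 * (d * 2 ^ (d + 1) * M * r * ∏ k, C.len k) + 2 * η) := by
  have hlen : ∀ k, 0 < C.len k := fun k => sub_pos.2 (hlt k)
  set V := ∏ k, C.len k with hV
  set A := ∏ k ∈ Finset.univ \ {j}, C.len k with hA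
  have hVA : V = C.len j * A := prod_eq_mul_sdiff _ _
  have hA0 : 0 < A := Finset.prod_pos fun k _ => hlen k
  set E := d * 2 ^ (d + 1) * M * r * V with hE
  obtain ⟨hcut, hc1, hc2⟩ := h.cut_spec hC hlt j
  have hs := mul_pos h.ratio_pos (hlen j)
  set p := C.cut μ j with hp
  -- The slab bounds hold only inside `C`, while `q` lies in `C'`. Clamping to the side of `C` moves
  -- `q` by at most the corner error.
  set q' := max (C.lo j) (min q (C.hi j)) with hq'
  have hcl := hclose j
  rw [abs_le, abs_le] at hcl
  have hrl : 0 ≤ r * C.len j := mul_nonneg hr (hlen j).le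
  have hqq' : |q - q'| ≤ r * C.len j := by
    rw [abs_le, hq']
    rcases max_cases (C.lo j) (min q (C.hi j)) with ⟨e, h1⟩ | ⟨e, h1⟩ <;>
      rcases min_cases q (C.hi j) with ⟨e', h2⟩ | ⟨e', h2⟩ <;> rw [e] <;>
      constructor <;> linarith [hq.1, hq.2, hcl.1.1, hcl.2.2, hlt j]
  have hq'1 : C.lo j ≤ q' := le_max_left _ _
  have hq'2 : q' ≤ C.hi j := max_le (hlt j).le (min_le_right _ _)
  have e1 := h.abs_sub_le_of_close hr hr' hlt hclose
  have e2 : |μ.real (box C.lo (Function.update C.hi j q')) -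
      μ.real (box C'.lo (Function.update C'.hi j q))| ≤ E := by
    refine h.abs_perturb hr (fun k => (hlen k).le) (fun k => ?_) (fun k => ?_)
      (fun k => (hclose k).1) (fun k => ?_)
    · by_cases hk : k = j
      · subst hk
        have : C.len k = C.hi k - C.lo k := rfl
        have := hlen k
        simp only [Function.update_self]
        linarith
      · have := hlen k
        simp only [Function.update_of_ne hk, Cell.len] at *
        linarith
    · have h1 := abs_le.1 (hclose k).1
      have h2 := abs_le.1 (hclose k).2
      have h3 := mul_le_mul_of_nonneg_right hr' (hlen k).le
      have h4 : C.len k = C.hi k - C.lo k := rfl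
      by_cases hk : k = j
      · subst hk
        simp only [Function.update_self]
        linarith [hq.2]
      · simp only [Function.update_of_ne hk]
        linarith
    · by_cases hk : k = j
      · subst hk; simpa using hqq'
      · simpa [hk] using (hclose k).2
  rw [abs_le] at e1 e2 hmass
  -- Up to the slab between `q'` and `p`, the mass error is `E` from the lower parts, `E / 2` from
  -- half of the totals, and `2 * η` from the approximate halving.
  have hmain : m * A * |q' - p| ≤ 3 / 2 * E + 2 * η := by
    rcases le_total q' p with hle | hle
    · rw [abs_of_nonpos (sub_nonpos.2 hle)]
      have := (h.slab hC j hq'1 hle (by linarith)).1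
      rw [← hA] at this
      linarith [e1.1, e2.1, hmass.1]
    · rw [abs_of_nonneg (sub_nonneg.2 hle)]
      have := (h.slab hC j (by linarith) hle hq'2).1
      rw [← hA] at this
      linarith [e1.2, e2.2, hmass.2]
  have htri : |q - p| ≤ |q - q'| + |q' - p| := abs_sub_le _ _ _
  have hV0 : 0 < m * V := by rw [hVA]; exact mul_pos h.pos (mul_pos (hlen j) hA0)
  calc m * V * |q - p| ≤ m * V * (|q - q'| + |q' - p|) := by gcongr
    _ = m * V * |q - q'| + C.len j * (m * A * |q' - p|) := by rw [hVA]; ring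
    _ ≤ m * V * (r * C.len j) + C.len j * (3 / 2 * E + 2 * η) := by
        gcongr
        exact (hlen j).le
    _ = _ := by ring

end Sample

/-! ### Error recursion: the sample tree against the population tree -/

section Comparison

variable {μ : Measure (EuclideanSpace ℝ (Fin d))} {B : Cell d} {m M : ℝ} {n : ℕ}
  {x : Fin n → EuclideanSpace ℝ (Fin d)} {η : ℝ}

/-- Growth factor per level of the relative distance between the sample cells and the cells of
the population. -/
noncomputable def growth (d : ℕ) (m M : ℝ) : ℝ :=
  (2 + 3 / 2 * (d * 2 ^ (d + 1)) * (M / m)) / (m / (2 * M))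

/-- Bound for the relative distance between the sample cells and the cells of the population at
depth `k`, when boxes have mass error at most `η`. -/
noncomputable def relError (B : Cell d) (m M η : ℝ) (k : ℕ) : ℝ :=
  2 * η / (m * ∏ j, B.len j) * growth d m M ^ k

/-- Per level the volume bound loses the factor m/(2M) and `relError` gains `growth`. Their product
therefore never falls below its initial value, so the sampling error η stays dominated at every
depth. -/
lemma one_le_ratio_mul_growth {m M : ℝ} (hm : 0 < m) (hM : 0 < M) :
    1 ≤ m / (2 * M) * growth d m M := by
  have : m / (2 * M) * growth d m M = 2 + 3 / 2 * (d * 2 ^ (d + 1)) * (M / m) := by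
    rw [growth]; field_simp
  rw [this]
  have : 0 ≤ 3 / 2 * ((d : ℝ) * 2 ^ (d + 1)) * (M / m) := by positivity
  linarith

lemma BoxBounds.two_le_growth (h : BoxBounds μ B m M) : 2 ≤ growth d m M := by
  have h1 := one_le_ratio_mul_growth (d := d) h.pos h.nonneg
  have h2 := h.ratio_le
  have h3 := h.ratio_pos
  by_contra! hcon
  nlinarith

lemma BoxBounds.prod_len_pos (h : BoxBounds μ B m M) : 0 < ∏ j, B.len j :=
  Finset.prod_pos fun k _ => sub_pos.2 (h.lt k)

lemma BoxBounds.relError_nonneg (h : BoxBounds μ B m M) (hη : 0 ≤ η) (k : ℕ) :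
    0 ≤ relError B m M η k := by
  have := h.prod_len_pos
  have := h.two_le_growth
  have := h.pos
  unfold relError
  positivity

lemma BoxBounds.relError_mono (h : BoxBounds μ B m M) (hη : 0 ≤ η) :
    Monotone (relError B m M η) := by
  intro k l hkl
  have := h.prod_len_pos
  have := h.two_le_growth
  have := h.pos
  unfold relError
  gcongr
  linarith

/-- The hypothesis says that moving the corners costs at most half of the guaranteed mass of a cell.
It already forces small `r`, because `4 ≤ d * 2 ^ (d + 1)` and `m ≤ M`. -/
lemma BoxBounds.le_one_eighth (h : BoxBounds μ B m M) (hd : 0 < d) {r : ℝ} (hr : 0 ≤ r)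
    (hr' : d * 2 ^ (d + 1) * M * r ≤ m / 2) : r ≤ 1 / 8 := by
  have h1 : (4 : ℝ) ≤ d * 2 ^ (d + 1) := by
    have h2 : (1 : ℝ) ≤ d := by exact_mod_cast hd
    have h3 : (2 : ℝ) ^ 2 ≤ 2 ^ (d + 1) := pow_le_pow_right₀ (by norm_num) (by omega)
    nlinarith
  have h2 : 4 * m * r ≤ d * 2 ^ (d + 1) * M * r := by
    gcongr
    · exact h.pos.le
    · exact h.le
  have h3 := h.pos
  by_contra! hcon
  nlinarith

/-- Sample cells close to population cells have a mass that exceeds the error. -/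
lemma BoxBounds.mass_of_close [IsFiniteMeasure μ] (h : BoxBounds μ B m M) (hd : 0 < d)
    (hη : 0 < η) (R : OrderingRule d) (σ : List Bool) {C' : Cell d}
    (hr : d * 2 ^ (d + 1) * M * relError B m M η σ.length ≤ m / 2)
    (hclose : (cell μ B R σ).Close C' (relError B m M η σ.length)) :
    8 * η ≤ μ.real (box C'.lo C'.hi) := by
  obtain ⟨hC, hlt, hvol, -⟩ := h.cell_spec R σ
  set C := cell μ B R σ
  have hr0 := h.relError_nonneg hη.le σ.length
  have hr8 := h.le_one_eighth hd hr0 hr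
  have hV0 := h.prod_len_pos
  have hV : 0 < ∏ k, C.len k := Finset.prod_pos fun k _ => sub_pos.2 (hlt k)
  have h1 := (abs_le.1 (h.abs_sub_le_of_close hr0 (by linarith) hlt hclose)).2
  have h2 : m * ∏ k, C.len k ≤ μ.real (box C.lo C.hi) := h.lower _ _ hC.lo hC.mid hC.hi
  have h3 : d * 2 ^ (d + 1) * M * relError B m M η σ.length * ∏ k, C.len k ≤
      m / 2 * ∏ k, C.len k := by gcongr
  have hs := h.ratio_pos
  -- As `growth` outweighs the volume loss, `relError ≤ 1 / 8` bounds η by the guaranteed mass: `16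
  -- * η` is at most m times the volume of the cell, and at least half of that mass survives in
  -- `C'`.
  have h4 : 8 * (2 * η / (m * ∏ j, B.len j)) ≤ (m / (2 * M)) ^ σ.length := by
    have h5 : (1 : ℝ) ≤ (m / (2 * M)) ^ σ.length * growth d m M ^ σ.length := by
      rw [← mul_pow]
      exact one_le_pow₀ (one_le_ratio_mul_growth h.pos h.nonneg)
    have h6 : 0 ≤ 2 * η / (m * ∏ j, B.len j) := by have := h.pos; positivity
    have h7 : (2 * η / (m * ∏ j, B.len j)) ≤ (m / (2 * M)) ^ σ.length *
        relError B m M η σ.length := by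
      unfold relError
      nlinarith
    have h8 : (m / (2 * M)) ^ σ.length * relError B m M η σ.length ≤
        (m / (2 * M)) ^ σ.length * (1 / 8) := by gcongr
    linarith
  have h9 : 16 * η ≤ m * ((m / (2 * M)) ^ σ.length * ∏ j, B.len j) := by
    have hmV : 0 < m * ∏ j, B.len j := mul_pos h.pos hV0
    rw [← mul_div_assoc, div_le_iff₀ hmV] at h4
    linarith
  have h10 : m * ((m / (2 * M)) ^ σ.length * ∏ j, B.len j) ≤ m * ∏ k, C.len k :=
    mul_le_mul_of_nonneg_left hvol h.pos.le
  linarith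

lemma GoodSample.nonempty (hx : GoodSample μ B x η) {C : Cell d} (hC : C.Sub B)
    {I : Finset (Fin n)} (hI : ∀ i, i ∈ I ↔ x i ∈ box C.lo C.hi)
    (hmass : η < μ.real (box C.lo C.hi)) : I.Nonempty := by
  by_contra hne
  rw [Finset.not_nonempty_iff_eq_empty] at hne
  have := hx.dev C hC
  rw [empMass_eq hI, hne] at this
  simp only [Finset.card_empty, Nat.cast_zero, zero_div, zero_sub, abs_neg] at this
  linarith [le_abs_self (μ.real (box C.lo C.hi))]

/-- The side of the child is at least `s` times that of its parent, so errors relative to it grow by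
at most 1/s; this is the condition `r ≤ s * r₁`. -/
lemma Cell.Close.half {C C' : Cell d} {r r₁ s q q' : ℝ} {j : Fin d} (hclose : C.Close C' r)
    (hlt : ∀ k, C.lo k < C.hi k) (hq1 : s * C.len j ≤ q - C.lo j) (hq2 : s * C.len j ≤ C.hi j - q)
    (hr₁ : 0 ≤ r₁) (hs : s ≤ 1) (hr : r ≤ s * r₁) (hqq : |q' - q| ≤ r₁ * (s * C.len j)) (b : Bool) :
    (C.half j q b).Close (C'.half j q' b) r₁ := by
  intro k
  have hlen : 0 < C.len k := sub_pos.2 (hlt k)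
  by_cases hk : k = j
  · subst hk
    have h1 : s * C.len k ≤ (C.half k q b).len k := by
      cases b <;> simpa [Cell.half, Cell.len] using by assumption
    have h2 : |q' - q| ≤ r₁ * (C.half k q b).len k :=
      hqq.trans (mul_le_mul_of_nonneg_left h1 hr₁)
    have h3 : r * C.len k ≤ r₁ * (C.half k q b).len k := by
      calc r * C.len k ≤ s * r₁ * C.len k := by gcongr
        _ = r₁ * (s * C.len k) := by ring
        _ ≤ _ := mul_le_mul_of_nonneg_left h1 hr₁
    have h4 := (hclose k).1.trans h3
    have h5 := (hclose k).2.trans h3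
    cases b
    · exact ⟨by simpa [Cell.half] using h4, by simpa [Cell.half] using h2⟩
    · exact ⟨by simpa [Cell.half] using h2, by simpa [Cell.half] using h5⟩
  · rw [Cell.half_len_of_ne _ hk, (Cell.half_of_ne C hk _ _).1, (Cell.half_of_ne C hk _ _).2,
      (Cell.half_of_ne C' hk _ _).1, (Cell.half_of_ne C' hk _ _).2]
    have h1 : r ≤ r₁ := hr.trans (mul_le_of_le_one_left hr₁ hs)
    exact ⟨(hclose k).1.trans (by gcongr), (hclose k).2.trans (by gcongr)⟩

/-- One level of the error recursion. -/
lemma BoxBounds.cut_relError [IsFiniteMeasure μ] (h : BoxBounds μ B m M) (hd : 0 < d)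
    (hη : 0 < η) (R : OrderingRule d) (σ : List Bool) {C' : Cell d}
    (hr : d * 2 ^ (d + 1) * M * relError B m M η σ.length ≤ m / 2)
    (hclose : (cell μ B R σ).Close C' (relError B m M η σ.length)) (j : Fin d) {q : ℝ}
    (hq : q ∈ Icc (C'.lo j) (C'.hi j))
    (hmass : |μ.real (box C'.lo (Function.update C'.hi j q)) -
        μ.real (box C'.lo C'.hi) / 2| ≤ 2 * η) :
    |q - (cell μ B R σ).cut μ j| ≤
      relError B m M η (σ.length + 1) * (m / (2 * M) * (cell μ B R σ).len j) := by
  obtain ⟨hC, hlt, hvol, -⟩ := h.cell_spec R σ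
  set C := cell μ B R σ
  set k := σ.length
  have hr0 := h.relError_nonneg hη.le k
  have hr8 := h.le_one_eighth hd hr0 hr
  have hmain := h.cut_close hC hlt hr0 (by linarith) hclose j hq hmass
  set r := relError B m M η k with hrdef
  set V := ∏ k, C.len k with hVdef
  have hV : 0 < V := Finset.prod_pos fun k _ => sub_pos.2 (hlt k)
  have hlen : 0 < C.len j := sub_pos.2 (hlt j)
  have hV0 := h.prod_len_pos
  have hm := h.pos
  have hM := h.nonneg
  have hs := h.ratio_pos
  -- The initial value of `relError` is chosen to make this an equality at the root, although the
  -- two root cells coincide. Deeper down it persists by `one_le_ratio_mul_growth`.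
  have h2η : 2 * η ≤ m * V * r := by
    have h5 : (1 : ℝ) ≤ (m / (2 * M)) ^ k * growth d m M ^ k := by
      rw [← mul_pow]
      exact one_le_pow₀ (one_le_ratio_mul_growth h.pos h.nonneg)
    have h6 : 2 * η = m * (∏ j, B.len j) * (2 * η / (m * ∏ j, B.len j)) := by
      field_simp
    have h7 : m * V * r ≥ m * ((m / (2 * M)) ^ k * ∏ j, B.len j) * r := by gcongr
    have h8 : m * ((m / (2 * M)) ^ k * ∏ j, B.len j) * r =
        2 * η * ((m / (2 * M)) ^ k * growth d m M ^ k) := by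
      rw [hrdef, relError]
      field_simp
    nlinarith
  -- The 2 consists of 1 for the clamping and 1 for `2 * η ≤ m * V * r`; the other term comes from
  -- the perturbed masses. The denominator of `growth` converts to the smaller side of the child.
  have hsucc : relError B m M η (k + 1) * (m / (2 * M)) =
      r * (2 + 3 / 2 * (d * 2 ^ (d + 1)) * (M / m)) := by
    rw [hrdef, relError, relError, pow_succ]
    have : growth d m M * (m / (2 * M)) = 2 + 3 / 2 * (d * 2 ^ (d + 1)) * (M / m) := by
      rw [growth, div_mul_cancel₀ _ hs.ne']
    rw [← this]
    ring
  have hmV : 0 < m * V := mul_pos hm hV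
  refine le_of_mul_le_mul_left (hmain.trans ?_) hmV
  calc C.len j * (m * r * V + 3 / 2 * (d * 2 ^ (d + 1) * M * r * V) + 2 * η)
      ≤ C.len j * (m * r * V + 3 / 2 * (d * 2 ^ (d + 1) * M * r * V) + m * V * r) := by gcongr
    _ = m * V * (r * (2 + 3 / 2 * (d * 2 ^ (d + 1)) * (M / m)) * C.len j) := by
        field_simp
        ring
    _ = m * V * (relError B m M η (k + 1) * (m / (2 * M) * C.len j)) := by
        rw [← hsucc]; ring

/-- Down to the depth where the error bound stops being small, the sample tree follows the
population tree. -/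
lemma BoxBounds.treeState_spec [IsFiniteMeasure μ] (h : BoxBounds μ B m M) (hd : 0 < d)
    (hη : 0 < η) (hη' : η < μ.real (box B.lo B.hi)) (hx : GoodSample μ B x η)
    (R : OrderingRule d) (σ : List Bool)
    (hr : d * 2 ^ (d + 1) * M * relError B m M η σ.length ≤ m / 2) :
    (treeState x R σ).active = true ∧ (treeState x R σ).idx.Nonempty ∧
      ∃ C' : Cell d, C'.Sub B ∧ (∀ i, i ∈ (treeState x R σ).idx ↔ x i ∈ box C'.lo C'.hi) ∧
        (cell μ B R σ).Close C' (relError B m M η σ.length) ∧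
        ∀ k, 0 < R.splitCount k σ → (treeState x R σ).cuts k ∈ Icc (C'.lo k) (C'.hi k) := by
  induction σ with
  | nil =>
    have hB : B.Sub B := Cell.Sub.refl fun k => (h.lt k).le
    have hI : ∀ i, i ∈ (Finset.univ : Finset (Fin n)) ↔ x i ∈ box B.lo B.hi :=
      fun i => by simpa using hx.mem i
    refine ⟨rfl, hx.nonempty hB hI hη', B, hB, hI, fun k => ?_, fun k hk => ?_⟩
    · have : 0 ≤ relError B m M η 0 * B.len k :=
        mul_nonneg (h.relError_nonneg hη.le 0) (sub_nonneg.2 (h.lt k).le)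
      simpa [cell] using this
    · simp [OrderingRule.splitCount] at hk
  | cons b σ ih =>
    have hM := h.nonneg
    have hr' : d * 2 ^ (d + 1) * M * relError B m M η σ.length ≤ m / 2 := by
      refine le_trans ?_ hr
      gcongr
      exact h.relError_mono hη.le (by simp)
    obtain ⟨hact, hne, C', hC', hI, hclose, hcuts⟩ := ih hr'
    obtain ⟨hC, hlt, -, -⟩ := h.cell_spec R σ
    set j := R.axis σ with hj
    set S := treeState x R σ with hS
    set q := sampleMedian x S.idx j with hq
    obtain ⟨hqmem, hqmass⟩ := h.sampleMedian_mass hη hx hC' hI hne j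
    have h8 := h.mass_of_close hd hη R σ hr' hclose
    have hsplit := measureReal_box_split μ C'.lo C'.hi j hqmem
    have hqmass' := abs_le.1 hqmass
    have hI₀ : ∀ i, i ∈ (S.idx.filter fun i => x i j ≤ q) ↔
        x i ∈ box (C'.half j q false).lo (C'.half j q false).hi := by
      intro i
      simp only [Cell.half, Bool.false_eq_true, if_false]
      rw [box_update_hi_eq _ _ _ hqmem.2, Finset.mem_filter, hI]
      rfl
    have hI₁ : ∀ i, i ∈ S.idx \ (S.idx.filter fun i => x i j ≤ q) ↔
        x i ∈ box (C'.half j q true).lo (C'.half j q true).hi := by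
      intro i
      simp only [Cell.half, if_true]
      rw [box_update_lo_eq _ _ _ hqmem.1, Finset.mem_sdiff, Finset.mem_filter, hI, Set.mem_sdiff,
        mem_ofPred_eq]
      tauto
    -- Each half has mass at least 8η/2 - 2η, which exceeds η, so both contain sample points and the
    -- traversal goes on.
    have hne₀ := hx.nonempty (hC'.half hqmem false) hI₀
      (by simp only [Cell.half, Bool.false_eq_true, if_false]; linarith [hqmass'.1])
    have hne₁ := hx.nonempty (hC'.half hqmem true) hI₁
      (by simp only [Cell.half, if_true]; linarith [hqmass'.2])
    have hstep : treeState x R (b :: σ) =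
        { idx := if R.goesUp σ b then S.idx \ (S.idx.filter fun i => x i j ≤ q)
            else S.idx.filter fun i => x i j ≤ q
          cuts := Function.update S.cuts j q
          active := true } := by
      change S.step x j (R.goesUp σ b) = _
      rw [TreeState.step, if_pos hact]
      simp only [← hq]
      rw [if_neg (not_or.2 ⟨hne₀.ne_empty, hne₁.ne_empty⟩)]
    obtain ⟨-, hc1, hc2⟩ := h.cut_spec hC hlt j
    have hcell : cell μ B R (b :: σ) =
        (cell μ B R σ).half j ((cell μ B R σ).cut μ j) (R.goesUp σ b) := rfl
    rw [hstep, hcell]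
    refine ⟨rfl, ?_, C'.half j q (R.goesUp σ b), hC'.half hqmem _, ?_, ?_, ?_⟩
    · cases R.goesUp σ b
      · simpa using hne₀
      · simpa using hne₁
    · cases R.goesUp σ b
      · simpa using hI₀
      · simpa using hI₁
    · refine hclose.half hlt hc1 hc2 (h.relError_nonneg hη.le _) (by linarith [h.ratio_le]) ?_
        (h.cut_relError hd hη R σ hr' hclose j hqmem hqmass) _
      have h1 := one_le_ratio_mul_growth (d := d) h.pos h.nonneg
      have h2 := h.relError_nonneg hη.le σ.length
      have h3 : relError B m M η (σ.length + 1) = growth d m M * relError B m M η σ.length := by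
        rw [relError, relError, pow_succ]; ring
      change _ ≤ m / (2 * M) * relError B m M η (σ.length + 1)
      rw [h3, ← mul_assoc]
      exact le_mul_of_one_le_left h2 h1
    · intro k hk
      by_cases hkj : k = j
      · subst hkj
        simpa using Cell.mem_half_self hqmem (R.goesUp σ b)
      · rw [(Cell.half_of_ne _ hkj _ _).1, (Cell.half_of_ne _ hkj _ _).2]
        simp only [Function.update_of_ne hkj]
        exact hcuts k (by simpa [OrderingRule.splitCount, ← hj, Ne.symm hkj] using hk)

/-- Once every axis has been split, further steps keep the cuts inside the cell. -/
lemma treeState_append_cuts_mem (R : OrderingRule d) {C : Cell d} (τ σ : List Bool)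
    (hne : (treeState x R σ).idx.Nonempty)
    (hI : ∀ i ∈ (treeState x R σ).idx, x i ∈ box C.lo C.hi)
    (hcuts : ∀ k, (treeState x R σ).cuts k ∈ Icc (C.lo k) (C.hi k)) :
    (treeState x R (τ ++ σ)).idx.Nonempty ∧
      (∀ i ∈ (treeState x R (τ ++ σ)).idx, x i ∈ box C.lo C.hi) ∧
      ∀ k, (treeState x R (τ ++ σ)).cuts k ∈ Icc (C.lo k) (C.hi k) := by
  induction τ with
  | nil => exact ⟨hne, hI, hcuts⟩
  | cons b τ ih =>
    obtain ⟨h1, h2, h3⟩ := ih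
    rw [List.cons_append, treeState]
    set S := treeState x R (τ ++ σ)
    set j := R.axis (τ ++ σ)
    -- The median is a coordinate of a sample point of the node, so no estimate is needed.
    have hq : sampleMedian x S.idx j ∈ Icc (C.lo j) (C.hi j) := by
      obtain ⟨⟨i, hi, hqi⟩, -⟩ := sampleMedian_spec (x := x) h1 j
      rw [hqi]
      exact Ioc_subset_Icc_self (h2 i hi j)
    have hcuts' : ∀ k, Function.update S.cuts j (sampleMedian x S.idx j) k ∈
        Icc (C.lo k) (C.hi k) := by
      intro k
      by_cases hk : k = j
      · subst hk; simpa using hq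
      · simpa [hk] using h3 k
    by_cases ha : S.active
    · rw [TreeState.step, if_pos ha]
      dsimp only
      split_ifs with he hu
      -- The traversal stops here, but the last cut is still stored.
      · exact ⟨h1, h2, hcuts'⟩
      · rw [not_or] at he
        exact ⟨Finset.nonempty_iff_ne_empty.2 he.2,
          fun i hi => h2 i (Finset.mem_sdiff.1 hi).1, hcuts'⟩
      · rw [not_or] at he
        exact ⟨Finset.nonempty_iff_ne_empty.2 he.1,
          fun i hi => h2 i (Finset.mem_filter.1 hi).1, hcuts'⟩
    · rw [TreeState.step, if_neg ha]
      exact ⟨h1, h2, h3⟩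

lemma norm_le_of_coord_le {v : EuclideanSpace ℝ (Fin d)} {e : ℝ} (he : 0 ≤ e)
    (hv : ∀ k, |v k| ≤ e) : ‖v‖ ≤ d * e := by
  rw [EuclideanSpace.norm_eq, Real.sqrt_le_iff]
  refine ⟨by positivity, ?_⟩
  calc ∑ i, ‖v i‖ ^ 2 ≤ ∑ _i : Fin d, e ^ 2 := by
        gcongr with i
        exact hv i
    _ = d * e ^ 2 := by simp
    _ ≤ d ^ 2 * e ^ 2 := by
        gcongr
        exact_mod_cast Nat.le_self_pow two_ne_zero d
    _ = (d * e) ^ 2 := by ring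

/-- Deterministic comparison of the empirical and the population quantile maps. -/
lemma BoxBounds.norm_sub_le [IsFiniteMeasure μ] (h : BoxBounds μ B m M) (hd : 0 < d)
    (hη : 0 < η) (hη' : η < μ.real (box B.lo B.hi)) (hx : GoodSample μ B x η)
    {R : OrderingRule d} {c : ℝ} (hR : R.IsBalanced c) (hc : 0 < c) {K L : ℕ} (hKL : K ≤ L)
    (hr : d * 2 ^ (d + 1) * M * relError B m M η K ≤ m / 2) (t : ℝ)
    (hsplit : ∀ k, 0 < R.splitCount k (addr t K)) {e : ℝ} (he : 0 ≤ e)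
    (hlen : ∀ k, 2 * (B.len k * (1 - m / (2 * M)) ^ R.splitCount k (addr t K)) ≤ e) :
    ‖empQuantileMap x R L t - quantileMap μ B R t‖ ≤ d * e := by
  rw [← length_addr t K] at hr
  obtain ⟨-, hne, C', -, hI, hclose, hcuts⟩ := h.treeState_spec hd hη hη' hx R (addr t K) hr
  have hr8 := h.le_one_eighth hd (h.relError_nonneg hη.le _) hr
  obtain ⟨τ, hτ⟩ := addr_of_le t hKL
  obtain ⟨-, -, hE⟩ := treeState_append_cuts_mem R (C := C') τ (addr t K) hne
    (fun i hi => (hI i).1 hi) (fun k => hcuts k (hsplit k))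
  refine norm_le_of_coord_le he fun k => ?_
  have h1 : empQuantileMap x R L t k ∈ Icc (C'.lo k) (C'.hi k) := by
    have := hE k
    rw [← hτ] at this
    exact this
  have h2 := h.quantileMap_mem hR hc t K k (hsplit k)
  obtain ⟨-, hlt, -, hl⟩ := h.cell_spec R (addr t K)
  have h3 := (hl k).trans (le_of_eq rfl)
  have h4 := abs_le.1 (hclose k).1
  have h5 := abs_le.1 (hclose k).2
  have h6 : 0 < (cell μ B R (addr t K)).len k := sub_pos.2 (hlt k)
  have h7 := mul_le_mul_of_nonneg_right hr8 h6.le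
  have h8 : (cell μ B R (addr t K)).len k =
    (cell μ B R (addr t K)).hi k - (cell μ B R (addr t K)).lo k := rfl
  have h9 := hlen k
  -- The limit lies in the population cell, the empirical cut in that cell enlarged by 1/8 of its
  -- side; they differ by at most 9/8 of the side.
  rw [PiLp.sub_apply, abs_le]
  constructor <;> linarith [h1.1, h1.2, h2.1, h2.2]

end Comparison

/-! ### Uniform deviations of the empirical mass on boxes -/

section Deviation

variable {μ : Measure (EuclideanSpace ℝ (Fin d))} {B : Cell d} {m M : ℝ}

lemma empMass_eq_sum {n : ℕ} (x : Fin n → EuclideanSpace ℝ (Fin d))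
    (S : Set (EuclideanSpace ℝ (Fin d))) :
    empMass x S = (∑ i, S.indicator (fun _ => (1 : ℝ)) (x i)) / n := by
  classical
  simp [empMass, Set.indicator_apply]

lemma empMass_mono {n : ℕ} (x : Fin n → EuclideanSpace ℝ (Fin d))
    {S T : Set (EuclideanSpace ℝ (Fin d))} (h : S ⊆ T) : empMass x S ≤ empMass x T := by
  rw [empMass_eq_sum, empMass_eq_sum]
  gcongr

variable {Ω : Type*} [MeasurableSpace Ω] {P : Measure Ω} [IsProbabilityMeasure P]
  {U : ℕ → Ω → EuclideanSpace ℝ (Fin d)}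

/-- Chebyshev's inequality for the empirical mass of a set. -/
lemma measure_empMass_dev_le (hU : ∀ i, Measurable (U i)) (hind : iIndepFun U P)
    (hlaw : ∀ i, P.map (U i) = μ) {S : Set (EuclideanSpace ℝ (Fin d))} (hS : MeasurableSet S)
    {n : ℕ} (hn : 0 < n) {η : ℝ} (hη : 0 < η) :
    P {ω | η < |empMass (fun i : Fin n => U i ω) S - μ.real S|} ≤
      ENNReal.ofReal (1 / (n * η ^ 2)) := by
  have hn' : (0 : ℝ) < n := by exact_mod_cast hn
  let g : EuclideanSpace ℝ (Fin d) → ℝ := S.indicator fun _ => 1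
  have hg : Measurable g := measurable_const.indicator hS
  let X : Fin n → Ω → ℝ := fun i ω => g (U i ω)
  have hX : ∀ i, Measurable (X i) := fun i => hg.comp (hU i)
  have hbd : ∀ i ω, X i ω ∈ Icc (0 : ℝ) 1 := by
    intro i ω
    by_cases hω : U i ω ∈ S <;> simp [X, g, hω]
  have hLp : ∀ i, MemLp (X i) 2 P := fun i =>
    MemLp.of_bound (hX i).aestronglyMeasurable 1 (ae_of_all _ fun ω => by
      rw [Real.norm_eq_abs, abs_le]
      constructor <;> linarith [(hbd i ω).1, (hbd i ω).2])
  have hindep : ((Finset.univ : Finset (Fin n)) : Set (Fin n)).Pairwise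
      fun i j => IndepFun (X i) (X j) P := by
    intro i _ j _ hij
    exact (hind.indepFun (fun h => hij (Fin.ext h))).comp hg hg
  have hvar : Var[∑ i, X i; P] ≤ n := by
    rw [IndepFun.variance_sum (fun i _ => hLp i) hindep]
    calc ∑ i, Var[X i; P] ≤ ∑ _i : Fin n, (1 : ℝ) := by
          refine Finset.sum_le_sum fun i _ => ?_
          refine (variance_le_sq_of_bounded (ae_of_all _ (hbd i)) (hX i).aemeasurable).trans ?_
          norm_num
      _ = n := by simp
  have hint : ∫ ω, (∑ i, X i) ω ∂P = n * μ.real S := by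
    simp only [Finset.sum_apply]
    rw [integral_finsetSum _ fun i _ => (hLp i).integrable one_le_two]
    have : ∀ i : Fin n, ∫ ω, X i ω ∂P = μ.real S := by
      intro i
      rw [← integral_indicator_one hS, ← hlaw i]
      exact (integral_map (hU i).aemeasurable hg.aestronglyMeasurable).symm
    simp [this]
  have hsum : MemLp (∑ i, X i) 2 P := memLp_finsetSum' _ fun i _ => hLp i
  refine le_trans (measure_mono fun ω hω => ?_)
    ((meas_ge_le_variance_div_sq hsum (mul_pos hn' hη)).trans (ENNReal.ofReal_le_ofReal ?_))
  · rw [mem_ofPred_eq, empMass_eq_sum] at hω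
    rw [mem_ofPred_eq, hint, Finset.sum_apply]
    change η < |(∑ i, X i ω) / n - μ.real S| at hω
    have : (∑ i, X i ω) - n * μ.real S = n * ((∑ i, X i ω) / n - μ.real S) := by
      field_simp
    rw [this, abs_mul, abs_of_pos hn']
    gcongr
  · rw [div_le_div_iff₀ (by positivity) (by positivity)]
    calc Var[∑ i, X i; P] * (n * η ^ 2) ≤ n * (n * η ^ 2) := by gcongr
      _ = 1 * (n * η) ^ 2 := by ring

/-- Points of a regular grid of mesh `1 / N` in the box `B`. -/
noncomputable def gridPoint (B : Cell d) (N : ℕ) (a : Fin d → ℕ) (j : Fin d) : ℝ :=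
  B.lo j + a j / N * B.len j

lemma box_subset_box {lo hi lo' hi' : Fin d → ℝ} (h1 : lo' ≤ lo) (h2 : hi ≤ hi') :
    box lo hi ⊆ box lo' hi' :=
  fun _ hu j => ⟨(h1 j).trans_lt (hu j).1, (hu j).2.trans (h2 j)⟩

/-- Every subcell is bracketed by two grid boxes. -/
lemma BoxBounds.exists_bracket [IsFiniteMeasure μ] (h : BoxBounds μ B m M) {N : ℕ} (hN : 0 < N)
    {C : Cell d} (hC : C.Sub B) :
    -- The inner lower index `⌊u j⌋₊ + 1` can reach N + 1; the inner box is then empty.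
    ∃ a b a' b' : Fin d → Fin (N + 2),
      box (gridPoint B N fun j => a j) (gridPoint B N fun j => b j) ⊆ box C.lo C.hi ∧
      box C.lo C.hi ⊆ box (gridPoint B N fun j => a' j) (gridPoint B N fun j => b' j) ∧
      μ.real (box (gridPoint B N fun j => a' j) (gridPoint B N fun j => b' j)) ≤
        μ.real (box (gridPoint B N fun j => a j) (gridPoint B N fun j => b j)) +
          d * 2 ^ (d + 1) * M * (1 / N) * ∏ k, B.len k := by
  have hN' : (0 : ℝ) < N := by exact_mod_cast hN
  have hlen : ∀ k, 0 < B.len k := fun k => sub_pos.2 (h.lt k)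
  let u : Fin d → ℝ := fun j => (C.lo j - B.lo j) / B.len j * N
  let v : Fin d → ℝ := fun j => (C.hi j - B.lo j) / B.len j * N
  have hu0 : ∀ j, 0 ≤ u j := fun j =>
    mul_nonneg (div_nonneg (sub_nonneg.2 (hC.lo j)) (hlen j).le) hN'.le
  have huv : ∀ j, u j ≤ v j := fun j => by
    have := hlen j
    have := hC.mid j
    simp only [u, v]
    gcongr
  have hvN : ∀ j, v j ≤ N := by
    intro j
    refine mul_le_of_le_one_left hN'.le ((div_le_one (hlen j)).2 ?_)
    have := hC.hi j
    simp only [Cell.len]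
    linarith
  have hlo : ∀ j, C.lo j = B.lo j + u j / N * B.len j := by
    intro j
    have := (hlen j).ne'
    simp only [u]
    field_simp
    ring
  have hhi : ∀ j, C.hi j = B.lo j + v j / N * B.len j := by
    intro j
    have := (hlen j).ne'
    simp only [v]
    field_simp
    ring
  have hfl : ∀ j, ⌊u j⌋₊ ≤ N := fun j =>
    Nat.floor_le_of_le ((huv j).trans (hvN j))
  have hcl : ∀ j, ⌈v j⌉₊ ≤ N := fun j => Nat.ceil_le.2 (hvN j)
  have h1 : ∀ j, (⌊u j⌋₊ : ℝ) ≤ u j := fun j => Nat.floor_le (hu0 j)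
  have h2 : ∀ j, u j ≤ ⌊u j⌋₊ + 1 := fun j => (Nat.lt_floor_add_one _).le
  have h3 : ∀ j, v j ≤ ⌈v j⌉₊ := fun j => Nat.le_ceil _
  -- The inner indices are floor + 1 and ceiling - 1, so inner and outer faces differ by at most one
  -- mesh. The truncated subtraction is harmless when the ceiling is 0.
  have h4 : ∀ j, ((⌈v j⌉₊ - 1 : ℕ) : ℝ) ≤ v j := by
    intro j
    rcases Nat.eq_zero_or_pos ⌈v j⌉₊ with h0 | h0
    · rw [h0]; simpa using (hu0 j).trans (huv j)
    · rw [Nat.cast_sub h0]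
      have := Nat.ceil_lt_add_one ((hu0 j).trans (huv j))
      push_cast
      linarith
  have h5 : ∀ j, (⌈v j⌉₊ : ℝ) - ((⌈v j⌉₊ - 1 : ℕ) : ℝ) ≤ 1 := by
    intro j
    have : ⌈v j⌉₊ ≤ ⌈v j⌉₊ - 1 + 1 := by omega
    have : (⌈v j⌉₊ : ℝ) ≤ (⌈v j⌉₊ - 1 : ℕ) + 1 := by exact_mod_cast this
    linarith
  have hstep : ∀ (j : Fin d) (p q : ℝ), p ≤ q →
      B.lo j + p / N * B.len j ≤ B.lo j + q / N * B.len j := by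
    intro j p q hpq
    have := hlen j
    gcongr
  refine ⟨fun j => ⟨⌊u j⌋₊ + 1, by have := hfl j; omega⟩,
    fun j => ⟨⌈v j⌉₊ - 1, by have := hcl j; omega⟩,
    fun j => ⟨⌊u j⌋₊, by have := hfl j; omega⟩, fun j => ⟨⌈v j⌉₊, by have := hcl j; omega⟩,
    box_subset_box (fun j => ?_) (fun j => ?_), box_subset_box (fun j => ?_) (fun j => ?_),
    h.perturb (by positivity) (fun k => (hlen k).le) (fun j => ?_) (fun j => ?_) (fun j => ?_)⟩
  · rw [hlo, gridPoint]
    exact hstep _ _ _ (by push_cast; exact h2 j)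
  · rw [hhi, gridPoint]
    exact hstep _ _ _ (h4 j)
  · rw [hlo, gridPoint]
    exact hstep _ _ _ (h1 j)
  · rw [hhi, gridPoint]
    exact hstep _ _ _ (h3 j)
  · simp only [gridPoint]
    have e1 : (⌈v j⌉₊ : ℝ) / N * B.len j ≤ 1 * B.len j := by
      have := hlen j
      gcongr
      rw [div_le_one hN']
      exact_mod_cast hcl j
    have e2 : 0 ≤ (⌊u j⌋₊ : ℝ) / N * B.len j := by have := hlen j; positivity
    have := hlen j
    linarith
  · simp only [gridPoint]
    push_cast
    apply le_of_eq
    field_simp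
    ring
  · simp only [gridPoint]
    have := mul_le_mul_of_nonneg_right
      (div_le_div_of_nonneg_right (h5 j) hN'.le) (hlen j).le
    rw [sub_div, sub_mul] at this
    linarith

/-- Both masses are monotone, so the deviation on `C` is at most that on a bracketing grid box plus
the mass between the two brackets. -/
lemma BoxBounds.goodSample_of_grid [IsFiniteMeasure μ] (h : BoxBounds μ B m M) {N : ℕ}
    (hN : 0 < N) {n : ℕ} {x : Fin n → EuclideanSpace ℝ (Fin d)} {η η' : ℝ}
    (hmem : ∀ i, x i ∈ box B.lo B.hi)
    (hgrid : ∀ a b : Fin d → Fin (N + 2),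
      |empMass x (box (gridPoint B N fun j => a j) (gridPoint B N fun j => b j)) -
        μ.real (box (gridPoint B N fun j => a j) (gridPoint B N fun j => b j))| ≤ η)
    (hη' : η + d * 2 ^ (d + 1) * M * (1 / N) * ∏ k, B.len k ≤ η') : GoodSample μ B x η' := by
  refine ⟨hmem, fun C hC => ?_⟩
  obtain ⟨a, b, a', b', hin, hout, hmass⟩ := h.exists_bracket hN hC
  have h1 := empMass_mono x hin
  have h2 := empMass_mono x hout
  have h3 := measureReal_mono (μ := μ) hin
  have h4 := measureReal_mono (μ := μ) hout
  have h5 := abs_le.1 (hgrid a b)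
  have h6 := abs_le.1 (hgrid a' b')
  rw [abs_le]
  constructor <;> linarith [h5.1, h6.2]

/-- Union bound over the (N + 2)^(2d) pairs of grid corners. The inclusion of events holds only
almost surely, since sample points may leave the box on a null set. -/
lemma BoxBounds.measure_not_goodSample_le [IsFiniteMeasure μ] (h : BoxBounds μ B m M)
    (hU : ∀ i, Measurable (U i)) (hind : iIndepFun U P)
    (hlaw : ∀ i, P.map (U i) = μ) {n N : ℕ} (hn : 0 < n) (hN : 0 < N) {η η' : ℝ} (hη : 0 < η)
    (hη' : η + d * 2 ^ (d + 1) * M * (1 / N) * ∏ k, B.len k ≤ η') :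
    P {ω | ¬ GoodSample μ B (fun i : Fin n => U i ω) η'} ≤
      ENNReal.ofReal ((N + 2) ^ (2 * d) * (1 / (n * η ^ 2))) := by
  let ι := (Fin d → Fin (N + 2)) × (Fin d → Fin (N + 2))
  let S : ι → Set (EuclideanSpace ℝ (Fin d)) := fun p =>
    box (gridPoint B N fun j => p.1 j) (gridPoint B N fun j => p.2 j)
  have hae : ∀ᵐ ω ∂P, ∀ i, U i ω ∈ box B.lo B.hi := by
    rw [ae_all_iff]
    intro i
    have := h.supp
    rw [← hlaw i] at this
    exact ae_of_ae_map (hU i).aemeasurable this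
  have hsub : ({ω | ¬ GoodSample μ B (fun i : Fin n => U i ω) η'} : Set Ω) ≤ᵐ[P]
      (⋃ p : ι, {ω | η < |empMass (fun i : Fin n => U i ω) (S p) - μ.real (S p)|} : Set Ω) := by
    filter_upwards [hae] with ω hω hbad
    change ω ∈ ⋃ p : ι, {ω | η < |empMass (fun i : Fin n => U i ω) (S p) - μ.real (S p)|}
    by_contra hcon
    simp only [mem_iUnion, mem_ofPred_eq, not_exists, not_lt] at hcon
    exact hbad (h.goodSample_of_grid hN (fun i => hω i) (fun a b => hcon (a, b)) hη')
  calc P {ω | ¬ GoodSample μ B (fun i : Fin n => U i ω) η'}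
      ≤ P (⋃ p : ι, {ω | η < |empMass (fun i : Fin n => U i ω) (S p) - μ.real (S p)|}) :=
        measure_mono_ae hsub
    _ ≤ ∑ p : ι, P {ω | η < |empMass (fun i : Fin n => U i ω) (S p) - μ.real (S p)|} :=
        measure_iUnion_fintype_le _ _
    _ ≤ ∑ _p : ι, ENNReal.ofReal (1 / (n * η ^ 2)) :=
        Finset.sum_le_sum fun p _ =>
          measure_empMass_dev_le hU hind hlaw (measurableSet_box _ _) hn hη
    _ = ENNReal.ofReal ((N + 2) ^ (2 * d) * (1 / (n * η ^ 2))) := by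
        rw [Finset.sum_const, nsmul_eq_mul, ENNReal.ofReal_mul (by positivity)]
        congr 1
        rw [ENNReal.ofReal_pow (by positivity)]
        have : ENNReal.ofReal ((N : ℝ) + 2) = ((N + 2 : ℕ) : ℝ≥0∞) := by
          rw [← ENNReal.ofReal_natCast]; push_cast; rfl
        rw [this]
        simp [ι, two_mul, pow_add]

/-- Exponent of the uniform deviation bound on boxes. -/
noncomputable def devExponent (d : ℕ) : ℝ := ((4 * d + 4 : ℕ) : ℝ)⁻¹

lemma devExponent_pos (d : ℕ) : 0 < devExponent d := by
  unfold devExponent; positivity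

/-- With probability tending to one, the empirical mass of all boxes is uniformly close to the
mass of `μ`, at a polynomial rate. -/
lemma BoxBounds.tendsto_measure_not_goodSample [IsFiniteMeasure μ] (h : BoxBounds μ B m M)
    (hU : ∀ i, Measurable (U i)) (hind : iIndepFun U P) (hlaw : ∀ i, P.map (U i) = μ) :
    Tendsto (fun n : ℕ => P {ω | ¬ GoodSample μ B (fun i : Fin n => U i ω)
      ((1 + d * 2 ^ (d + 1) * M * ∏ k, B.len k) * ((n : ℝ) ^ devExponent d)⁻¹)})
      atTop (𝓝 0) := by
  have hy : Tendsto (fun n : ℕ => (n : ℝ) ^ devExponent d) atTop atTop :=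
    (tendsto_rpow_atTop (devExponent_pos d)).comp tendsto_natCast_atTop_atTop
  have hlim : Tendsto (fun n : ℕ => ENNReal.ofReal
      (4 ^ (2 * d) * (((n : ℝ) ^ devExponent d) ^ (2 * d + 2))⁻¹)) atTop (𝓝 0) := by
    have h1 := (tendsto_inv_atTop_zero.comp
      ((tendsto_pow_atTop (n := 2 * d + 2) (by omega)).comp hy)).const_mul ((4 : ℝ) ^ (2 * d))
    rw [mul_zero] at h1
    have h2 := ENNReal.tendsto_ofReal h1
    rw [ENNReal.ofReal_zero] at h2
    exact h2
  refine tendsto_of_tendsto_of_tendsto_of_le_of_le' tendsto_const_nhds hlim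
    (Eventually.of_forall fun _ => zero_le) ?_
  filter_upwards [eventually_gt_atTop 0, hy.eventually_ge_atTop 1] with n hn hy1
  -- With η = 1/y and mesh at most 1/y, the failure probability is of order y^(2d) · y²/n. The
  -- choice n = y^(4d + 4) turns this into y^(-(2d + 2)).
  set y := (n : ℝ) ^ devExponent d with hydef
  have hy0 : 0 < y := by linarith
  have hyn : (n : ℝ) = y ^ (4 * d + 4) := by
    rw [hydef, devExponent, Real.rpow_inv_natCast_pow (Nat.cast_nonneg n) (by omega)]
  have hN : 0 < ⌈y⌉₊ := Nat.ceil_pos.2 hy0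
  have hκ : 0 ≤ d * 2 ^ (d + 1) * M * ∏ k, B.len k := by
    have := h.nonneg
    have := h.prod_len_pos
    positivity
  refine (h.measure_not_goodSample_le hU hind hlaw hn hN (inv_pos.2 hy0) ?_).trans
    (ENNReal.ofReal_le_ofReal ?_)
  · have : (1 : ℝ) / ⌈y⌉₊ ≤ y⁻¹ := by
      rw [one_div]
      exact inv_anti₀ hy0 (Nat.le_ceil y)
    nlinarith
  · have hceil : (⌈y⌉₊ : ℝ) + 2 ≤ 4 * y := by
      linarith [Nat.ceil_lt_add_one hy0.le]
    calc ((⌈y⌉₊ : ℝ) + 2) ^ (2 * d) * (1 / (n * y⁻¹ ^ 2))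
        ≤ (4 * y) ^ (2 * d) * (1 / (n * y⁻¹ ^ 2)) := by gcongr
      _ = 4 ^ (2 * d) * (y ^ (2 * d + 2))⁻¹ := by
          rw [hyn, mul_pow]
          field_simp
          ring

end Deviation

/-! ### Integrability -/

lemma measurable_bit (l : ℕ) : Measurable fun t => bit t l :=
  (measurable_from_top (f := fun k : ℕ => (min k (2 ^ l - 1)).testBit 0)).comp
    (Nat.measurable_floor.comp (measurable_id.mul_const _))

/-- Induction on the depth with `g` general: one more digit selects between two functions of the
shorter address. -/
lemma measurable_comp_addr {E : Type*} [MeasurableSpace E] (l : ℕ) (g : List Bool → E) :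
    Measurable fun t => g (addr t l) := by
  induction l generalizing g with
  | zero => exact (measurable_const : Measurable fun _ : ℝ => g [])
  | succ l ih =>
    have : (fun t => g (addr t (l + 1))) = fun t =>
        if bit t (l + 1) = true then g (true :: addr t l) else g (false :: addr t l) := by
      ext t
      rw [addr]
      cases bit t (l + 1) <;> simp
    rw [this]
    exact Measurable.ite (measurable_bit (l + 1) (measurableSet_singleton true))
      (ih fun σ => g (true :: σ)) (ih fun σ => g (false :: σ))

lemma memLp_comp_addr (l : ℕ) (g : List Bool → EuclideanSpace ℝ (Fin d)) (p : ℝ≥0∞)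
    (ν : Measure ℝ) [IsFiniteMeasure ν] : MemLp (fun t => g (addr t l)) p ν := by
  obtain ⟨C, hC⟩ := (((List.finite_length_eq Bool l).image fun σ => ‖g σ‖).bddAbove)
  exact MemLp.of_bound (measurable_comp_addr l g).aestronglyMeasurable C
    (ae_of_all _ fun t => hC ⟨addr t l, length_addr t l, rfl⟩)

section Rate

variable {μ : Measure (EuclideanSpace ℝ (Fin d))} {B : Cell d} {m M : ℝ}

/-- The map is a pointwise limit of functions of finite addresses, and its values lie in the root
box. -/
lemma BoxBounds.memLp_quantileMap [IsFiniteMeasure μ] (h : BoxBounds μ B m M)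
    {R : OrderingRule d} {c : ℝ} (hR : R.IsBalanced c) (hc : 0 < c) (p : ℝ≥0∞)
    (ν : Measure ℝ) [IsFiniteMeasure ν] : MemLp (quantileMap μ B R) p ν := by
  have hmeas : AEStronglyMeasurable (quantileMap μ B R) ν :=
    aestronglyMeasurable_of_tendsto_ae atTop
      (fun l => (measurable_comp_addr l fun σ =>
        (WithLp.toLp 2 (lastCuts μ B R σ) : EuclideanSpace ℝ (Fin d))).aestronglyMeasurable)
      (ae_of_all _ fun t => h.tendsto_quantileMap hR hc t)
  refine MemLp.of_bound hmeas (d * ∑ k, (|B.lo k| + |B.hi k|)) (ae_of_all _ fun t => ?_)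
  refine norm_le_of_coord_le (by positivity) fun k => ?_
  obtain ⟨K, hK⟩ := ((hR.tendsto_splitCount hc k t).eventually_gt_atTop 0).exists
  have h1 := h.quantileMap_mem hR hc t K k hK
  have h2 := (h.cell_spec R (addr t K)).1
  have h3 : |B.lo k| + |B.hi k| ≤ ∑ k, (|B.lo k| + |B.hi k|) :=
    Finset.single_le_sum (f := fun k => |B.lo k| + |B.hi k|) (fun _ _ => by positivity)
      (Finset.mem_univ k)
  refine le_trans ?_ h3
  rw [abs_le]
  constructor
  · linarith [neg_abs_le (B.lo k), abs_nonneg (B.hi k), h1.1, h2.lo k]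
  · linarith [le_abs_self (B.hi k), abs_nonneg (B.lo k), h1.2, h2.hi k]

/-! ### The rate of convergence -/

/-- The depth, in units of `log n`, down to which the sample tree follows the population tree. -/
noncomputable def matchDepth (d : ℕ) (m M a : ℝ) : ℝ :=
  min a (devExponent d / (2 * Real.log (growth d m M)))

/-- The exponent `γ` in the rate of convergence. -/
noncomputable def rateExponent (d : ℕ) (m M a : ℝ) : ℝ :=
  (2 * matchDepth d m M a * -Real.log (1 - m / (2 * M)))⁻¹

lemma one_lt_growth {m M : ℝ} (hm : 0 < m) (hM : m ≤ M) : 1 < growth d m M := by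
  have hM0 := hm.trans_le hM
  have h1 := one_le_ratio_mul_growth (d := d) hm hM0
  have h2 : m / (2 * M) ≤ 1 / 2 := by rw [div_le_iff₀ (by positivity)]; linarith
  have h3 : 0 < m / (2 * M) := by positivity
  by_contra! hcon
  nlinarith

lemma matchDepth_pos {m M a : ℝ} (hm : 0 < m) (hM : m ≤ M) (ha : 0 < a) :
    0 < matchDepth d m M a :=
  lt_min ha (div_pos (devExponent_pos d)
    (mul_pos two_pos (Real.log_pos (one_lt_growth hm hM))))

lemma neg_log_shrink_pos {m M : ℝ} (hm : 0 < m) (hM : m ≤ M) :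
    0 < -Real.log (1 - m / (2 * M)) := by
  have hM0 := hm.trans_le hM
  have h2 : m / (2 * M) ≤ 1 / 2 := by rw [div_le_iff₀ (by positivity)]; linarith
  have h3 : 0 < m / (2 * M) := by positivity
  exact neg_pos.2 (Real.log_neg (by linarith) (by linarith))

lemma rateExponent_pos {m M a : ℝ} (hm : 0 < m) (hM : m ≤ M) (ha : 0 < a) :
    0 < rateExponent d m M a :=
  inv_pos.2 (mul_pos (mul_pos two_pos (matchDepth_pos hm hM ha)) (neg_log_shrink_pos hm hM))

/-- Down to the matching depth the amplification of errors uses up only half of the exponent in the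
deviation bound. -/
lemma growth_pow_le {m M a : ℝ} (hm : 0 < m) (hM : m ≤ M) (ha : 0 < a) {n : ℕ} (hn : 1 ≤ n) :
    growth d m M ^ ⌊matchDepth d m M a * Real.log n⌋₊ ≤ (n : ℝ) ^ (devExponent d / 2) := by
  have hD := one_lt_growth (d := d) hm hM
  have hlog := Real.log_pos hD
  have hn' : (1 : ℝ) ≤ n := by exact_mod_cast hn
  have hln := Real.log_nonneg hn'
  have hK : (⌊matchDepth d m M a * Real.log n⌋₊ : ℝ) ≤ matchDepth d m M a * Real.log n :=
    Nat.floor_le (mul_nonneg (matchDepth_pos hm hM ha).le hln)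
  rw [← Real.rpow_natCast, Real.rpow_def_of_pos (by linarith), Real.rpow_def_of_pos (by linarith)]
  refine Real.exp_le_exp.2 ?_
  have h1 : matchDepth d m M a * Real.log (growth d m M) ≤ devExponent d / 2 := by
    calc matchDepth d m M a * Real.log (growth d m M)
        ≤ devExponent d / (2 * Real.log (growth d m M)) * Real.log (growth d m M) := by
          gcongr
          exact min_le_right _ _
      _ = devExponent d / 2 := by field_simp
  calc Real.log (growth d m M) * ⌊matchDepth d m M a * Real.log n⌋₊
      ≤ Real.log (growth d m M) * (matchDepth d m M a * Real.log n) := by gcongr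
    _ = Real.log n * (matchDepth d m M a * Real.log (growth d m M)) := by ring
    _ ≤ Real.log n * (devExponent d / 2) := by gcongr

/-- At depth about δ log n the shrinkage is (1 - s)^(cδ log n / d), with s = m/(2M), and γ is
defined so that this equals n^(-c/(2dγ)). The constant factor pays for the rounding of the depth
(c/d) and the defect κ in the balance. -/
lemma shrink_pow_le {m M a c κ : ℝ} (hd : 0 < d) (hm : 0 < m) (hM : m ≤ M) (hc : 0 < c)
    {n k : ℕ} (hn : 1 ≤ n)
    (hk : c * ⌊matchDepth d m M a * Real.log n⌋₊ / d - κ ≤ k) :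
    (1 - m / (2 * M)) ^ k ≤ (1 - m / (2 * M)) ^ (-(c / d + κ)) *
      (n : ℝ) ^ (-(c / (2 * d * rateExponent d m M a))) := by
  have hM0 := hm.trans_le hM
  have hd' : (0 : ℝ) < d := by exact_mod_cast hd
  have h2 : m / (2 * M) ≤ 1 / 2 := by rw [div_le_iff₀ (by positivity)]; linarith
  have hn' : (0 : ℝ) < n := by exact_mod_cast hn
  have hρ : 0 < 1 - m / (2 * M) := by linarith
  have hlog := neg_log_shrink_pos hm hM
  set ρ := 1 - m / (2 * M)
  set δ := matchDepth d m M a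
  rw [← Real.rpow_natCast, Real.rpow_def_of_pos hρ, Real.rpow_def_of_pos hρ,
    Real.rpow_def_of_pos hn', ← Real.exp_add]
  refine Real.exp_le_exp.2 ?_
  have h3 : c / (2 * d * rateExponent d m M a) = c / d * (δ * -Real.log ρ) := by
    change c / (2 * d * (2 * δ * -Real.log ρ)⁻¹) = _
    generalize -Real.log ρ = l
    field_simp
  rw [h3]
  have h4 : δ * Real.log n - 1 ≤ ⌊δ * Real.log n⌋₊ := (Nat.sub_one_lt_floor _).le
  have h5 : c / d * (δ * Real.log n - 1) - κ ≤ k := by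
    refine le_trans ?_ hk
    have : c / d * (δ * Real.log n - 1) ≤ c / d * ⌊δ * Real.log n⌋₊ := by gcongr
    rw [mul_div_right_comm]
    linarith
  nlinarith [mul_le_mul_of_nonneg_left h5 hlog.le]

/-- On good samples the empirical quantile map is uniformly close to the population one. -/
lemma BoxBounds.eventually_norm_sub_le [IsFiniteMeasure μ] (h : BoxBounds μ B m M) (hd : 0 < d)
    {R : OrderingRule d} {c : ℝ} (hR : R.IsBalanced c) (hc : 0 < c) {a : ℝ} (ha : 0 < a)
    {L : ℕ → ℕ} (hL : ∀ᶠ n : ℕ in atTop, a * Real.log n ≤ L n) :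
    ∃ C : ℝ, ∀ᶠ n : ℕ in atTop, ∀ x : Fin n → EuclideanSpace ℝ (Fin d),
      GoodSample μ B x
        ((1 + d * 2 ^ (d + 1) * M * ∏ k, B.len k) * ((n : ℝ) ^ devExponent d)⁻¹) →
      ∀ t, ‖empQuantileMap x R (L n) t - quantileMap μ B R t‖ ≤
        C * (n : ℝ) ^ (-(c / (2 * d * rateExponent d m M a))) := by
  have hm := h.pos
  have hM := h.le
  have hM0 := h.nonneg
  have hV := h.prod_len_pos
  have hd' : (0 : ℝ) < d := by exact_mod_cast hd
  have hα := devExponent_pos d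
  have hδ := matchDepth_pos (d := d) hm hM ha
  obtain ⟨κ, hκ⟩ := hR
  set W := 1 + d * 2 ^ (d + 1) * M * ∏ k, B.len k with hW
  have hW0 : 0 < W := by positivity
  set K : ℕ → ℕ := fun n => ⌊matchDepth d m M a * Real.log n⌋₊ with hK
  have hKtop : Tendsto (fun n => (K n : ℝ)) atTop atTop :=
    tendsto_natCast_atTop_atTop.comp (tendsto_nat_floor_atTop.comp
      ((Real.tendsto_log_atTop.comp tendsto_natCast_atTop_atTop).const_mul_atTop hδ))
  have hηlim : Tendsto (fun n : ℕ => W * ((n : ℝ) ^ devExponent d)⁻¹) atTop (𝓝 0) := by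
    have := (tendsto_inv_atTop_zero.comp
      ((tendsto_rpow_atTop hα).comp (tendsto_natCast_atTop_atTop (R := ℝ)))).const_mul W
    rw [mul_zero] at this
    exact this
  have hrlim : Tendsto (fun n : ℕ => d * 2 ^ (d + 1) * M *
      (2 * W / (m * ∏ j, B.len j) * (n : ℝ) ^ (-(devExponent d / 2)))) atTop (𝓝 0) := by
    have := (((tendsto_rpow_neg_atTop (half_pos hα)).comp
      (tendsto_natCast_atTop_atTop (R := ℝ))).const_mul
        (2 * W / (m * ∏ j, B.len j))).const_mul (d * 2 ^ (d + 1) * M)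
    rw [mul_zero, mul_zero] at this
    exact this
  have hsplitlim : Tendsto (fun n => c / d * (K n : ℝ) + -κ) atTop atTop :=
    tendsto_atTop_add_const_right _ _ (hKtop.const_mul_atTop (div_pos hc hd'))
  have hmass : 0 < μ.real (box B.lo B.hi) :=
    (mul_pos hm hV).trans_le (h.lower _ _ le_rfl (fun j => (h.lt j).le) le_rfl)
  -- The factor `d` passes from coordinates to the norm, 2 comes from `norm_sub_le`, and the sum
  -- bounds every side of the root.
  refine ⟨d * (2 * ((∑ k, B.len k) * (1 - m / (2 * M)) ^ (-(c / d + κ)))), ?_⟩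
  filter_upwards [hL, eventually_ge_atTop 1, hηlim.eventually (gt_mem_nhds hmass),
    hrlim.eventually (gt_mem_nhds (half_pos hm)), hsplitlim.eventually_gt_atTop 0]
    with n hLn hn hηn hrn hsn x hx t
  have hn' : (1 : ℝ) ≤ n := by exact_mod_cast hn
  have hn0 : (0 : ℝ) < n := by linarith
  have hlen0 : ∀ k, 0 < B.len k := fun k => sub_pos.2 (h.lt k)
  have hρ : 0 < 1 - m / (2 * M) := by linarith [h.ratio_le]
  have hKL : K n ≤ L n := by
    have h1 : (K n : ℝ) ≤ matchDepth d m M a * Real.log n :=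
      Nat.floor_le (mul_nonneg hδ.le (Real.log_nonneg hn'))
    have h2 : matchDepth d m M a * Real.log n ≤ a * Real.log n :=
      mul_le_mul_of_nonneg_right (min_le_left _ _) (Real.log_nonneg hn')
    exact_mod_cast h1.trans (h2.trans hLn)
  have hr : d * 2 ^ (d + 1) * M *
      relError B m M (W * ((n : ℝ) ^ devExponent d)⁻¹) (K n) ≤ m / 2 := by
    refine le_trans ?_ hrn.le
    gcongr
    calc relError B m M (W * ((n : ℝ) ^ devExponent d)⁻¹) (K n)
        ≤ 2 * (W * ((n : ℝ) ^ devExponent d)⁻¹) / (m * ∏ j, B.len j) *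
          (n : ℝ) ^ (devExponent d / 2) := by
          unfold relError
          gcongr
          exact growth_pow_le hm hM ha hn
      _ = 2 * W / (m * ∏ j, B.len j) *
          -- The deviation exponent minus the half spent on `growth` leaves half of it, so the
          -- relative error vanishes.
          ((n : ℝ) ^ (-devExponent d) * (n : ℝ) ^ (devExponent d / 2)) := by
          rw [Real.rpow_neg hn0.le]; ring
      _ = 2 * W / (m * ∏ j, B.len j) * (n : ℝ) ^ (-(devExponent d / 2)) := by
          rw [← Real.rpow_add hn0]; congr 2; ring
  have hcount : ∀ k, c * K n / d - κ ≤ R.splitCount k (addr t (K n)) := by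
    intro k
    have := hκ (addr t (K n)) k
    rwa [length_addr] at this
  have hpos : ∀ k, 0 < R.splitCount k (addr t (K n)) := by
    intro k
    have h1 := hcount k
    have h2 : c * K n / d = c / d * K n := by ring
    have : (0 : ℝ) < R.splitCount k (addr t (K n)) := by linarith
    exact_mod_cast this
  set e : ℝ := 2 * ((∑ k, B.len k) * ((1 - m / (2 * M)) ^ (-(c / d + κ)) *
    (n : ℝ) ^ (-(c / (2 * d * rateExponent d m M a))))) with he
  have hsum : 0 ≤ ∑ k, B.len k := Finset.sum_nonneg fun k _ => (hlen0 k).le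
  have he0 : 0 ≤ e := by positivity
  refine (h.norm_sub_le hd (by positivity) hηn hx ⟨κ, hκ⟩ hc hKL hr t hpos he0
    fun k => ?_).trans (le_of_eq ?_)
  · rw [he]
    gcongr
    · exact Finset.single_le_sum (f := B.len) (fun k _ => (hlen0 k).le) (Finset.mem_univ k)
    · exact shrink_pow_le hd hm hM hc hn (hcount k)
  · rw [he]; ring

end Rate

/-! ### From the uniform bound to the metric, and the theorem -/

lemma dist₂_le_iSup (Q Q' : ℝ → EuclideanSpace ℝ (Fin d)) :
    dist₂ Q Q' ≤ ⨆ t ∈ Icc (0 : ℝ) 1, ‖Q t - Q' t‖ₑ := by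
  set s := ⨆ t ∈ Icc (0 : ℝ) 1, ‖Q t - Q' t‖ₑ with hs
  have h1 : ∫⁻ t in Icc (0 : ℝ) 1, ‖Q t - Q' t‖ₑ ^ 2 ≤ s ^ 2 := by
    calc ∫⁻ t in Icc (0 : ℝ) 1, ‖Q t - Q' t‖ₑ ^ 2 ≤ ∫⁻ _ in Icc (0 : ℝ) 1, s ^ 2 := by
          refine setLIntegral_mono' measurableSet_Icc fun t ht => ?_
          gcongr
          exact le_iSup₂ (f := fun t (_ : t ∈ Icc (0 : ℝ) 1) => ‖Q t - Q' t‖ₑ) t ht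
      _ = s ^ 2 := by simp
  calc dist₂ Q Q' ≤ (s ^ 2) ^ (1 / 2 : ℝ) := ENNReal.rpow_le_rpow h1 (by norm_num)
    _ = s := by
      rw [← ENNReal.rpow_natCast, ← ENNReal.rpow_mul]
      norm_num

lemma IsBigOp.mono {Ω : Type*} [MeasurableSpace Ω] {P : Measure Ω} {X Y : ℕ → Ω → ℝ≥0∞}
    {r : ℕ → ℝ} (h : IsBigOp P Y r) (hXY : ∀ n ω, X n ω ≤ Y n ω) : IsBigOp P X r := by
  intro ε hε
  obtain ⟨C, hC⟩ := h ε hε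
  refine ⟨C, hC.mono fun n hn => (measure_mono fun ω hω => ?_).trans hn⟩
  exact lt_of_lt_of_le hω (hXY n ω)

end HiMAP

open HiMAP in
theorem corollary1 (d : ℕ) [NeZero d] :
    -- the Hilbert curve rule is an admissible ordering rule, with constant `1`
    (hilbertRule d).IsBalanced 1 ∧
    -- the box, the density bounds, and the constants in `L ≍ log n`
    ∀ (B : Cell d) (m M a b : ℝ), 0 < m → 0 < a →
    ∃ γ : ℝ, 0 < γ ∧
    ∀ (μ : Measure (EuclideanSpace ℝ (Fin d))) [IsProbabilityMeasure μ]
      (f : EuclideanSpace ℝ (Fin d) → ℝ), Measurable f →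
      μ = (volume.restrict B.toSet).withDensity (fun u => ENNReal.ofReal (f u)) →
      (∀ u ∈ B.toSet, m ≤ f u ∧ f u ≤ M) →
    ∀ (R : OrderingRule d) (c : ℝ), 0 < c → R.IsBalanced c →
    ∀ L : ℕ → ℕ, (∀ᶠ n : ℕ in atTop, a * Real.log n ≤ L n ∧ (L n : ℝ) ≤ b * Real.log n) →
    ∀ (Ω : Type*) [MeasurableSpace Ω] (P : Measure Ω) [IsProbabilityMeasure P]
      (U : ℕ → Ω → EuclideanSpace ℝ (Fin d)), (∀ i, Measurable (U i)) →
      iIndepFun U P → (∀ i, P.map (U i) = μ) →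
    -- the population quantile function is well defined
    (∀ t ∈ Icc (0 : ℝ) 1,
      Tendsto (fun l => finiteMap μ B R l t) atTop (𝓝 (quantileMap μ B R t))) ∧
    (∀ (n : ℕ) (ω : Ω),
      MemLp (fun t => empQuantileMap (fun i : Fin n => U i ω) R (L n) t - quantileMap μ B R t) 2
        (volume.restrict (Icc (0 : ℝ) 1))) ∧
    -- the rate, uniformly in `t`
    IsBigOp P
      (fun n ω => ⨆ t ∈ Icc (0 : ℝ) 1,
        ‖empQuantileMap (fun i : Fin n => U i ω) R (L n) t - quantileMap μ B R t‖ₑ)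
      (fun n => (n : ℝ) ^ (-(c / (2 * d * γ)))) ∧
    -- the rate in the HiMAP metric
    IsBigOp P
      (fun n ω => dist₂ (empQuantileMap (fun i : Fin n => U i ω) R (L n)) (quantileMap μ B R))
      (fun n => (n : ℝ) ^ (-(c / (2 * d * γ)))) := by
  refine ⟨hilbertRule_isBalanced d, fun B m M a b hm ha => ?_⟩
  -- γ is chosen before μ. If M < m, no μ satisfies the bounds and any γ will do.
  by_cases hmM : m ≤ M
  swap
  · refine ⟨1, one_pos, fun μ _ f _ hμ hb => ?_⟩
    exact absurd (boxBounds_of_density B hm μ f hμ hb).le hmM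
  refine ⟨rateExponent d m M a, rateExponent_pos hm hmM ha, ?_⟩
  intro μ _ f _ hμ hb R c hc hR L hL Ω _ P _ U hU hind hlaw
  have h := boxBounds_of_density B hm μ f hμ hb
  have hd : 0 < d := Nat.pos_of_ne_zero (NeZero.ne d)
  have hsup : IsBigOp P
      (fun n ω => ⨆ t ∈ Icc (0 : ℝ) 1,
        ‖empQuantileMap (fun i : Fin n => U i ω) R (L n) t - quantileMap μ B R t‖ₑ)
      (fun n => (n : ℝ) ^ (-(c / (2 * d * rateExponent d m M a)))) := by
    intro ε hε
    -- The constant does not depend on ε: the bound is deterministic on good samples, whose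
    -- probability tends to 1.
    obtain ⟨C, hC⟩ := h.eventually_norm_sub_le hd hR hc ha (hL.mono fun n hn => hn.1)
    refine ⟨C, ?_⟩
    filter_upwards [hC, (h.tendsto_measure_not_goodSample hU hind hlaw).eventually
      (gt_mem_nhds (ENNReal.ofReal_pos.2 hε))] with n hn hbad
    refine (measure_mono fun ω hω => ?_).trans hbad.le
    intro hgood
    rw [mem_ofPred_eq] at hω
    refine absurd hω (not_lt.2 (iSup₂_le fun t _ => ?_))
    rw [← ofReal_norm]
    exact ENNReal.ofReal_le_ofReal (hn _ hgood t)
  refine ⟨fun t _ => h.tendsto_quantileMap hR hc t, fun n ω => ?_, hsup,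
    hsup.mono fun n ω => dist₂_le_iSup _ _⟩
  -- For a fixed sample, the empirical map depends on t only through its first `L n` digits.
  exact (memLp_comp_addr (L n) (fun σ => (WithLp.toLp 2
    (treeState (fun i : Fin n => U i ω) R σ).cuts : EuclideanSpace ℝ (Fin d))) 2 _).sub
    (h.memLp_quantileMap hR hc 2 _)
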